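/- **Continuity of nested risk functionals.** Let $\Xi_1,\dots,\Xi_T$ be non-empty Polish spaces, let $d$ be a metric on $\Xi=\Xi_1\times\dots\times\Xi_T$ which generates the product topology, and let $P,\tilde P$ be Borel probability measures on $\Xi$. Write $P_t(\cdot\mid x_{1:t-1})$ for the regular conditional distribution on $\Xi_t$ of the $t$-th coordinate given the first $t-1$ coordinates $x_{1:t-1}=(x_1,\dots,x_{t-1})$ under $P$, and similarly for $\tilde P$. *Risk functionals.* A distortion function is a nondecreasing $\sigma\colon[0,1)\to[0,\infty)$ with $\int_0^1\sigma(u)\,du=1$; $\|\sigma\|_q$ is its norm in $L^q([0,1))$. With $\mathrm{AVaR}_{\alpha;P}(Z)=\inf_{a\in\mathbb R}\{a+\frac1{1-\alpha}E_P(Z-a)_+\}$, a collection $\mathcal S$ of distortion functions defines $$\mathcal R_{\mathcal S;P}(Y)=\sup\Big\{E_P[Y\zeta]:\ \zeta\ge0,\ E_P\zeta=1,\ \exists\,\sigma\in\mathcal S\ \forall\alpha\in(0,1):\ \mathrm{AVaR}_{\alpha;P}(\zeta)\le\tfrac1{1-\alpha}\int_\alpha^1\sigma(u)\,du\Big\}.$$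 For non-empty collections $\mathcal S_1,\dots,\mathcal S_T$ the nested risk functional is $\mathcal R_{\mathcal S_{1:T};P}(Y)=Y_0$, where $Y_T=Y$ and $Y_{t-1}(x_{1:t-1})=\mathcal R_{\mathcal S_t;P_t(\cdot\mid x_{1:t-1})}\big(Y_t(x_{1:t-1},\cdot)\big)$ for $t=T,\dots,1$. *Nested distance.* For $r\in[1,\infty)$ and a cost function $c\ge0$ let $w_r(\mu,\nu;c)=\inf_\pi\big(\int c^r\,d\pi\big)^{1/r}$, the infimum being over all measures $\pi$ with marginals $\mu$ and $\nu$. Put $c_T=d$ and $$c_{t-1}(x_{1:t-1},y_{1:t-1})=w_r\big(P_t(\cdot\mid x_{1:t-1}),\tilde P_t(\cdot\mid y_{1:t-1});\,c_t\big),\qquad t=T,\dots,1,$$ where $c_t$ is regarded as a function of the $t$-th coordinates of its two arguments, the earlier ones being fixed. The nested distance is $\mathsf{d}_r(P,\tilde P)=c_0\in[0,\infty]$. *Theorem.* Let $r\in[1,\infty)$ and $q\in(1,\infty]$ with $\frac1r+\frac1q=1$. Let $p,p'\in[1,\infty]$ with $\frac1p+\frac1{p'}=1$ be such that the risk functionals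 are finite on $L^p$ in the sense that $\sup_{\sigma\in\mathcal S_t}\|\sigma\|_{p'}<\infty$ for every $t$, and let $Y\in L^p(P)\cap L^p(\tilde P)$. Suppose that $Y\colon\Xi\to\mathbb R$ is Hölder continuous with constant $L\ge0$ and exponent $\beta\in(0,1]$, i.e. $|Y(x)-Y(y)|\le L\,d(x,y)^\beta$ for all $x,y\in\Xi$. Then $$\left|\mathcal R_{\mathcal S_{1:T};P}(Y)-\mathcal R_{\mathcal S_{1:T};\tilde P}(Y)\right|\le\sup_{\sigma_t\in\mathcal S_t,\,t=1,\dots,T}\|\sigma_1\|_q\cdots\|\sigma_T\|_q\cdot L\cdot \mathsf{d}_r(P,\tilde P)^\beta,$$ where the right-hand side is an element of $[0,\infty]$ and $0\cdot\infty=0$. -/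

import Mathlib

open MeasureTheory ProbabilityTheory
open scoped ENNReal NNReal

noncomputable section

/-- `σ : [0,1) → ℝ` (values outside `[0,1)` are irrelevant) is a distortion function: nondecreasing,
nonnegative and of integral one. -/
structure IsDistortion (σ : ℝ → ℝ) : Prop where
  mono : MonotoneOn σ (Set.Ico 0 1)
  nonneg : ∀ u ∈ Set.Ico (0 : ℝ) 1, 0 ≤ σ u
  integral_eq_one : ∫ u in Set.Ico (0 : ℝ) 1, σ u = 1

/-- The norm `‖σ‖_q` of `σ` in `L^q([0,1))`, with values in `[0,∞]`. -/
def distortionNorm (q : ℝ≥0∞) (σ : ℝ → ℝ) : ℝ≥0∞ :=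
  eLpNorm σ q (volume.restrict (Set.Ico (0 : ℝ) 1))

/-- The Average Value-at-Risk at level `α` of `Z` under `P`. -/
def AVaR {Ω : Type*} [MeasurableSpace Ω] (P : Measure Ω) (α : ℝ) (Z : Ω → ℝ) : ℝ :=
  ⨅ a : ℝ, (a + 1 / (1 - α) * ∫ ω, max (Z ω - a) 0 ∂P)

/-- `ζ` is a density feasible for the distortion function `σ` under `P`. -/
structure IsFeasibleDensity {Ω : Type*} [MeasurableSpace Ω] (P : Measure Ω) (σ : ℝ → ℝ)
    (ζ : Ω → ℝ) : Prop where
  nonneg : 0 ≤ᵐ[P] ζ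
  integrable : Integrable ζ P
  integral_eq_one : ∫ ω, ζ ω ∂P = 1
  avar_le : ∀ α ∈ Set.Ioo (0 : ℝ) 1,
    AVaR P α ζ ≤ 1 / (1 - α) * ∫ u in Set.Ico α 1, σ u

/-- The risk functional `R_{S;P}(Y)`: the supremum of `E_P[Y ζ]` over all densities `ζ` that are
feasible for some distortion function in `S`. -/
def riskFunctional {Ω : Type*} [MeasurableSpace Ω] (S : Set (ℝ → ℝ)) (P : Measure Ω)
    (Y : Ω → ℝ) : ℝ :=
  sSup {e : ℝ | ∃ σ ∈ S, ∃ ζ : Ω → ℝ, IsFeasibleDensity P σ ζ ∧ e = ∫ ω, Y ω * ζ ω ∂P}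

/-- The Wasserstein distance of order `r` for the cost function `c`: the infimum of
`(∫ c^r dπ)^(1/r)` over all measures `π` with marginals `P` and `Q`. -/
def wasserstein {Ω Ω' : Type*} [MeasurableSpace Ω] [MeasurableSpace Ω'] (r : ℝ)
    (P : Measure Ω) (Q : Measure Ω') (c : Ω → Ω' → ℝ≥0∞) : ℝ≥0∞ :=
  ⨅ π ∈ {π : Measure (Ω × Ω') | π.fst = P ∧ π.snd = Q},
    (∫⁻ z, c z.1 z.2 ^ r ∂π) ^ (1 / r)

universe u

/-- The marginal of a measure on `Ξ₁ × ⋯ × Ξₙ₊₁` on the first `n` coordinates. -/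
abbrev initMarginal {n : ℕ} {Ξ : Fin (n + 1) → Type u} [∀ i, MeasurableSpace (Ξ i)]
    (P : Measure (∀ i, Ξ i)) : Measure (∀ i : Fin n, Ξ i.castSucc) :=
  P.map (fun x (i : Fin n) => x i.castSucc)

/-- The disintegration kernel `P(· | x₁, …, xₙ)` on `Ξₙ₊₁` of a measure `P` on `Ξ₁ × ⋯ × Ξₙ₊₁`. -/
abbrev lastKernel {n : ℕ} {Ξ : Fin (n + 1) → Type u} [∀ i, MeasurableSpace (Ξ i)]
    [∀ i, StandardBorelSpace (Ξ i)] [∀ i, Nonempty (Ξ i)]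
    (P : Measure (∀ i, Ξ i)) [IsFiniteMeasure P] :
    Kernel (∀ i : Fin n, Ξ i.castSucc) (Ξ (Fin.last n)) :=
  condDistrib (fun x : (∀ i, Ξ i) => x (Fin.last n))
    (fun x (i : Fin n) => x i.castSucc) P

/-- The nested risk functional `R_{S₁;…}( … R_{Sₙ}(Y | x₁,…,xₙ₋₁) … )` of `Y` under the measure `P`
on `Ξ₁ × ⋯ × Ξₙ`: apply the risk functional of the last stage on each fiber, then proceed with the
resulting function of `x₁,…,xₙ₋₁` and the marginal of `P` on the first `n - 1` coordinates. -/
def nestedRisk : {n : ℕ} → {Ξ : Fin n → Type u} → [∀ i, MeasurableSpace (Ξ i)] →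
    [∀ i, StandardBorelSpace (Ξ i)] → [∀ i, Nonempty (Ξ i)] →
    (S : Fin n → Set (ℝ → ℝ)) → (P : Measure (∀ i, Ξ i)) → [IsFiniteMeasure P] →
    (Y : (∀ i, Ξ i) → ℝ) → ℝ
  | 0, _, _, _, _, _, _, _, Y => Y (fun i => i.elim0)
  | n + 1, Ξ, _, _, _, S, P, _, Y =>
      nestedRisk (Ξ := fun i : Fin n => Ξ i.castSucc) (fun i => S i.castSucc) (initMarginal P)
        (fun x => riskFunctional (S (Fin.last n)) (lastKernel P x)
          (fun u => Y (Fin.snoc (α := Ξ) x u)))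

/-- The value `c₀` of the cost process with terminal cost `c = cₙ` on `Ξ₁ × ⋯ × Ξₙ`, where
`cₜ₋₁(x,y) = w_r(P(· | x₁,…,xₜ₋₁), Q(· | y₁,…,yₜ₋₁); cₜ)`. -/
def initialCost (r : ℝ) : {n : ℕ} → {Ξ : Fin n → Type u} → [∀ i, MeasurableSpace (Ξ i)] →
    [∀ i, StandardBorelSpace (Ξ i)] → [∀ i, Nonempty (Ξ i)] →
    (P Q : Measure (∀ i, Ξ i)) → [IsFiniteMeasure P] → [IsFiniteMeasure Q] →
    (c : (∀ i, Ξ i) → (∀ i, Ξ i) → ℝ≥0∞) → ℝ≥0∞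
  | 0, _, _, _, _, _, _, _, _, c => c (fun i => i.elim0) (fun i => i.elim0)
  | n + 1, Ξ, _, _, _, P, Q, _, _, c =>
      initialCost r (Ξ := fun i : Fin n => Ξ i.castSucc) (initMarginal P) (initMarginal Q)
        (fun x y => wasserstein r (lastKernel P x) (lastKernel Q y)
          (fun u v => c (Fin.snoc (α := Ξ) x u) (Fin.snoc (α := Ξ) y v)))

/-- The nested distance of order `r` with respect to the metric `d` on `Ξ₁ × ⋯ × Ξₙ`. -/
def nestedDistance {n : ℕ} {Ξ : Fin n → Type u} [∀ i, MeasurableSpace (Ξ i)]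
    [∀ i, StandardBorelSpace (Ξ i)] [∀ i, Nonempty (Ξ i)] (d : MetricSpace (∀ i, Ξ i)) (r : ℝ)
    (P Q : Measure (∀ i, Ξ i)) [IsFiniteMeasure P] [IsFiniteMeasure Q] : ℝ≥0∞ :=
  initialCost r P Q (fun x y => ENNReal.ofReal (d.dist x y))

end

/-! ### Stop-loss order and norms -/

/-! Two facts about a single stage carry the theorem. First, choosing the AVaR level so that a given
`a` becomes a quantile of `ζ` turns the feasibility constraints into the stop-loss inequalities `E(ζ
- a)₊ ≤ ∫ (σ - a)₊`. Since `z^s = s (s - 1) ∫₀^∞ a^(s-2) (z - a)₊ da` for `z ≥ 0`, integrating over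
`a` gives `‖ζ‖_s ≤ ‖σ‖_s` for `1 < s < ∞`; the case `s = ∞` is immediate
(`IsFeasibleDensity.eLpNorm_le`). Second, if `π` couples `μ` and `ν`, the conditional expectation of
`ζ` given the second coordinate is again feasible, now under `ν`, because conditioning decreases
stop-loss integrals (`IsFeasibleDensity.exists_transfer`).

Comparing the objectives of `ζ` and of its transfer leaves `E_π[(Y - Z) ζ]`, so Hölder bounds the
difference of two risk functionals by `K ‖Y - Z‖_{L^r(π)}`, with `K` a bound for `‖σ‖_q`. If `|Y -
Z| ≤ C c^β`, then Jensen and the infimum over `π` give `K C w_r^β`. This is the hypothesis again,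
one stage earlier, with cost `w_r` and constant `K C`; backward induction
(`enorm_nestedRisk_sub_le`) multiplies the constants.

For the induction the conditional risk must stay in `L^p`, which requires its measurability: a
simple function has a law on a finite set, the risk functional is continuous in that law, and
general integrands are `L^p`-limits of simple ones on almost every fiber. This works for finite `p`;
if `p > r`, the exponent `r` replaces it.

The convention `0 · ∞ = 0` leaves two degenerate cases: `L = 0`, where `Y` is constant, and nested
distance zero, where the two measures coincide. -/

theorem lintegral_Ioi_rpow_mul_ofReal_sub {s z : ℝ} (hs : 1 < s) (hz : 0 ≤ z) :
    ∫⁻ a in Set.Ioi (0 : ℝ), ENNReal.ofReal (a ^ (s - 2)) * ENNReal.ofReal (z - a) =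
      ENNReal.ofReal (z ^ s / (s * (s - 1))) := by
  have hint : IntervalIntegrable (fun a : ℝ => z * a ^ (s - 2) - a ^ (s - 1)) volume 0 z :=
    ((intervalIntegral.intervalIntegrable_rpow' (by linarith)).const_mul z).sub
      (intervalIntegral.intervalIntegrable_rpow' (by linarith))
  have heq : ∀ a ∈ Set.Ioc 0 z, a ^ (s - 2) * (z - a) = z * a ^ (s - 2) - a ^ (s - 1) := by
    intro a ha
    have : a ^ (s - 1) = a ^ (s - 2) * a := by
      rw [← Real.rpow_add_one ha.1.ne']; ring_nf
    rw [this]; ring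
  calc ∫⁻ a in Set.Ioi (0 : ℝ), ENNReal.ofReal (a ^ (s - 2)) * ENNReal.ofReal (z - a)
      = ∫⁻ a in Set.Ioc 0 z, ENNReal.ofReal (a ^ (s - 2)) * ENNReal.ofReal (z - a) := by
        rw [← lintegral_indicator measurableSet_Ioi, ← lintegral_indicator measurableSet_Ioc]
        refine lintegral_congr fun a => ?_
        by_cases h0 : a ∈ Set.Ioi 0
        · by_cases h1 : a ≤ z
          · rw [Set.indicator_of_mem h0, Set.indicator_of_mem (Set.mem_Ioc.2 ⟨h0, h1⟩)]
          · rw [Set.indicator_of_mem h0, Set.indicator_of_notMem fun h => h1 h.2,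
              ENNReal.ofReal_of_nonpos (by linarith : z - a ≤ 0), mul_zero]
        · rw [Set.indicator_of_notMem h0, Set.indicator_of_notMem fun h => h0 h.1]
    _ = ∫⁻ a in Set.Ioc 0 z, ENNReal.ofReal (z * a ^ (s - 2) - a ^ (s - 1)) := by
        refine setLIntegral_congr_fun measurableSet_Ioc fun a ha => ?_
        rw [← heq a ha, ENNReal.ofReal_mul (Real.rpow_nonneg ha.1.le _)]
    _ = ENNReal.ofReal (∫ a in Set.Ioc 0 z, (z * a ^ (s - 2) - a ^ (s - 1))) := by
        refine (ofReal_integral_eq_lintegral_ofReal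
          ((intervalIntegrable_iff_integrableOn_Ioc_of_le hz).1 hint) ?_).symm
        filter_upwards [ae_restrict_mem measurableSet_Ioc] with a ha
        rw [← heq a ha]
        exact mul_nonneg (Real.rpow_nonneg ha.1.le _) (by linarith [ha.2])
    _ = ENNReal.ofReal (z ^ s / (s * (s - 1))) := by
        congr 1
        rw [← intervalIntegral.integral_of_le hz, intervalIntegral.integral_sub
          ((intervalIntegral.intervalIntegrable_rpow' (by linarith)).const_mul z)
          (intervalIntegral.intervalIntegrable_rpow' (by linarith)),
          intervalIntegral.integral_const_mul, integral_rpow (Or.inl (by linarith)),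
          integral_rpow (Or.inl (by linarith)), Real.zero_rpow (by linarith),
          Real.zero_rpow (by linarith)]
        have h1 : s - 2 + 1 = s - 1 := by ring
        have h2 : s - 1 + 1 = s := by ring
        rw [h1, h2, sub_zero, sub_zero]
        have h3 : z * z ^ (s - 1) = z ^ s := by
          rcases hz.eq_or_lt with rfl | hz
          · rw [Real.zero_rpow (by linarith), Real.zero_rpow (by linarith), mul_zero]
          · rw [mul_comm, ← Real.rpow_add_one hz.ne', h2]
        have h4 : s - 1 ≠ 0 := by linarith
        have h5 : s ≠ 0 := by linarith
        rw [← mul_div_assoc, h3]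
        field_simp
        ring

theorem lintegral_ofReal_rpow_eq_lintegral_stopLoss {Ω : Type*} [MeasurableSpace Ω]
    {μ : Measure Ω} [SFinite μ] {f : Ω → ℝ} (hf : AEMeasurable f μ) (hf0 : 0 ≤ᵐ[μ] f) {s : ℝ}
    (hs : 1 < s) :
    ∫⁻ x, ENNReal.ofReal (f x ^ s) ∂μ = ∫⁻ a in Set.Ioi (0 : ℝ),
      ENNReal.ofReal (s * (s - 1)) * ENNReal.ofReal (a ^ (s - 2)) *
        ∫⁻ x, ENNReal.ofReal (f x - a) ∂μ := by
  have hs' : 0 < s * (s - 1) := mul_pos (by linarith) (by linarith)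
  calc ∫⁻ x, ENNReal.ofReal (f x ^ s) ∂μ
      = ∫⁻ x, (∫⁻ a in Set.Ioi (0 : ℝ), ENNReal.ofReal (s * (s - 1)) *
          ENNReal.ofReal (a ^ (s - 2)) * ENNReal.ofReal (f x - a)) ∂μ := by
        refine lintegral_congr_ae ?_
        filter_upwards [hf0] with x hx
        simp_rw [mul_assoc]
        rw [lintegral_const_mul' _ _ ENNReal.ofReal_ne_top,
          lintegral_Ioi_rpow_mul_ofReal_sub hs hx, ← ENNReal.ofReal_mul hs'.le,
          mul_div_cancel₀ _ hs'.ne']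
    _ = ∫⁻ a in Set.Ioi (0 : ℝ), ∫⁻ x, ENNReal.ofReal (s * (s - 1)) *
          ENNReal.ofReal (a ^ (s - 2)) * ENNReal.ofReal (f x - a) ∂μ := by
        have h1 : AEMeasurable (fun z : Ω × ℝ => ENNReal.ofReal (s * (s - 1)) *
            ENNReal.ofReal (z.2 ^ (s - 2))) (μ.prod (volume.restrict (Set.Ioi 0))) :=
          Measurable.aemeasurable (by fun_prop)
        have h2 : AEMeasurable (fun z : Ω × ℝ => ENNReal.ofReal (f z.1 - z.2))
            (μ.prod (volume.restrict (Set.Ioi 0))) :=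
          (hf.comp_fst.sub measurable_snd.aemeasurable).ennreal_ofReal
        exact lintegral_lintegral_swap (h1.mul h2)
    _ = _ := by
        refine lintegral_congr fun a => ?_
        rw [lintegral_const_mul' _ _ (ENNReal.mul_ne_top ENNReal.ofReal_ne_top
          ENNReal.ofReal_ne_top)]

/-- The stop-loss order of nonnegative functions implies the order of the `L^s`-norms. -/
theorem eLpNorm_le_of_stopLoss_le {Ω Ω' : Type*} [MeasurableSpace Ω] [MeasurableSpace Ω']
    {μ : Measure Ω} {ν : Measure Ω'} [SFinite μ] [SFinite ν] {f : Ω → ℝ} {g : Ω' → ℝ}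
    (hf : AEMeasurable f μ) (hg : AEMeasurable g ν) (hf0 : 0 ≤ᵐ[μ] f) (hg0 : 0 ≤ᵐ[ν] g)
    (h : ∀ a : ℝ, ∫⁻ x, ENNReal.ofReal (f x - a) ∂μ ≤ ∫⁻ x, ENNReal.ofReal (g x - a) ∂ν)
    {s : ℝ≥0∞} (hs : 1 < s) : eLpNorm f s μ ≤ eLpNorm g s ν := by
  rcases eq_or_ne s ∞ with rfl | hs_top
  · rcases eq_or_ne (eLpNorm g ∞ ν) ∞ with hg_top | hg_top
    · rw [hg_top]; exact le_top
    -- At the essential supremum `a` of `g` the stop-loss integral of `g` vanishes, hence so does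
    -- that of `f`, which says `f ≤ a` almost everywhere.
    set a := (eLpNorm g ∞ ν).toReal with ha
    have hga : ∀ᵐ x ∂ν, g x ≤ a := by
      filter_upwards [enorm_ae_le_eLpNormEssSup g ν] with x hx
      rw [← eLpNorm_exponent_top] at hx
      have := (ENNReal.toReal_le_toReal (by simp) hg_top).2 hx
      rw [toReal_enorm] at this
      exact (le_abs_self _).trans this
    have h0 : ∫⁻ x, ENNReal.ofReal (f x - a) ∂μ = 0 := by
      refine le_antisymm ((h a).trans (le_of_eq ?_)) zero_le
      refine (lintegral_congr_ae ?_).trans lintegral_zero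
      filter_upwards [hga] with x hx
      exact ENNReal.ofReal_of_nonpos (by linarith)
    rw [lintegral_eq_zero_iff' (hf.sub_const a).ennreal_ofReal] at h0
    rw [eLpNorm_exponent_top, ← ENNReal.ofReal_toReal hg_top]
    refine eLpNormEssSup_le_of_ae_bound ?_
    filter_upwards [h0, hf0] with x hx hx0
    have := ENNReal.ofReal_eq_zero.1 hx
    rw [Real.norm_of_nonneg hx0]
    linarith
  · have hs1 : 1 < s.toReal := by
      have := (ENNReal.toReal_lt_toReal ENNReal.one_ne_top hs_top).2 hs
      simpa using this
    have key : ∀ {Ω : Type _} [MeasurableSpace Ω] {μ : Measure Ω} {f : Ω → ℝ}, 0 ≤ᵐ[μ] f →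
        ∫⁻ x, ‖f x‖ₑ ^ s.toReal ∂μ = ∫⁻ x, ENNReal.ofReal (f x ^ s.toReal) ∂μ := by
      intro Ω _ μ f hf0
      refine lintegral_congr_ae ?_
      filter_upwards [hf0] with x hx
      rw [Real.enorm_of_nonneg hx, ENNReal.ofReal_rpow_of_nonneg hx (by linarith)]
    have hs0 : s ≠ 0 := (zero_lt_one.trans hs).ne'
    rw [eLpNorm_eq_lintegral_rpow_enorm_toReal hs0 hs_top,
      eLpNorm_eq_lintegral_rpow_enorm_toReal hs0 hs_top]
    refine ENNReal.rpow_le_rpow ?_ (by positivity)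
    rw [key hf0]
    refine le_trans ?_ (lintegral_congr_ae ?_ : ∫⁻ x, ENNReal.ofReal (g x ^ s.toReal) ∂ν = _).le
    · rw [lintegral_ofReal_rpow_eq_lintegral_stopLoss hf hf0 hs1,
        lintegral_ofReal_rpow_eq_lintegral_stopLoss hg hg0 hs1]
      exact lintegral_mono fun a => mul_le_mul_right (h a) _
    · filter_upwards [hg0] with x hx
      rw [Real.enorm_of_nonneg hx, ENNReal.ofReal_rpow_of_nonneg hx (by linarith)]

/-! ### Distortion functions and feasible densities -/

theorem IsDistortion.integrableOn {σ : ℝ → ℝ} (h : IsDistortion σ) :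
    IntegrableOn σ (Set.Ico 0 1) := by
  by_contra hn
  have := h.integral_eq_one
  rw [integral_undef hn] at this
  exact zero_ne_one this

theorem IsDistortion.setIntegral_add {σ : ℝ → ℝ} (h : IsDistortion σ) {α : ℝ}
    (hα : α ∈ Set.Icc (0 : ℝ) 1) :
    (∫ u in Set.Ico 0 α, σ u) + ∫ u in Set.Ico α 1, σ u = 1 := by
  rw [← setIntegral_union Set.Ico_disjoint_Ico_same measurableSet_Ico
    (h.integrableOn.mono_set (Set.Ico_subset_Ico_right hα.2))
    (h.integrableOn.mono_set (Set.Ico_subset_Ico_left hα.1)),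
    Set.Ico_union_Ico_eq_Ico hα.1 hα.2, h.integral_eq_one]

/-- A nondecreasing function of mean one has mean at least one on each upper interval: either `σ α ≥
1`, and `σ ≥ 1` to the right of `α`, or `σ ≤ 1` to the left, where it then has integral at most `α`.
-/
theorem IsDistortion.one_sub_le_setIntegral {σ : ℝ → ℝ} (h : IsDistortion σ) {α : ℝ}
    (hα : α ∈ Set.Ioo (0 : ℝ) 1) : 1 - α ≤ ∫ u in Set.Ico α 1, σ u := by
  have hαm : α ∈ Set.Ico (0 : ℝ) 1 := ⟨hα.1.le, hα.2⟩
  rcases le_total 1 (σ α) with h1 | h1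
  · have : ∫ _ in Set.Ico α 1, (1 : ℝ) = 1 - α := by simp [hα.2.le]
    rw [← this]
    refine setIntegral_mono_on (by simp)
      (h.integrableOn.mono_set (Set.Ico_subset_Ico_left hα.1.le)) measurableSet_Ico fun u hu => ?_
    exact h1.trans (h.mono hαm ⟨hα.1.le.trans hu.1, hu.2⟩ hu.1)
  · have h2 : ∫ u in Set.Ico 0 α, σ u ≤ ∫ _ in Set.Ico 0 α, (1 : ℝ) := by
      refine setIntegral_mono_on (h.integrableOn.mono_set (Set.Ico_subset_Ico_right hα.2.le))
        (by simp) measurableSet_Ico fun u hu => ?_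
      exact (h.mono ⟨hu.1, hu.2.trans hα.2⟩ hαm hu.2.le).trans h1
    have h3 : ∫ _ in Set.Ico 0 α, (1 : ℝ) = α := by simp [hα.1.le]
    linarith [h.setIntegral_add ⟨hα.1.le, hα.2.le⟩]

instance isProbabilityMeasure_restrict_Ico_zero_one :
    IsProbabilityMeasure ((volume : Measure ℝ).restrict (Set.Ico 0 1)) :=
  ⟨by simp⟩

theorem IsDistortion.one_le_distortionNorm {σ : ℝ → ℝ} (h : IsDistortion σ) {q : ℝ≥0∞}
    (hq : 1 ≤ q) : 1 ≤ distortionNorm q σ := by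
  refine le_trans (le_of_eq ?_)
    (eLpNorm_le_eLpNorm_of_exponent_le hq h.integrableOn.aestronglyMeasurable)
  rw [eLpNorm_one_eq_lintegral_enorm, ← ofReal_integral_norm_eq_lintegral_enorm h.integrableOn,
    setIntegral_congr_fun measurableSet_Ico
      (g := σ) (fun u hu => Real.norm_of_nonneg (h.nonneg u hu)), h.integral_eq_one]
  simp

theorem MeasureTheory.MeasurePreserving.integral_comp_of_aestronglyMeasurable {Ω Ω' : Type*}
    [MeasurableSpace Ω] [MeasurableSpace Ω'] {μ : Measure Ω} {ν : Measure Ω'} {f : Ω → Ω'}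
    (hf : MeasurePreserving f μ ν) {g : Ω' → ℝ} (hg : AEStronglyMeasurable g ν) :
    ∫ x, g (f x) ∂μ = ∫ y, g y ∂ν := by
  rw [← hf.map_eq] at hg ⊢
  exact (integral_map hf.aemeasurable hg).symm

section Density

variable {Ω Ω' : Type*} [MeasurableSpace Ω] [MeasurableSpace Ω'] {μ : Measure Ω} {ν : Measure Ω'}
  {σ : ℝ → ℝ} {ζ : Ω → ℝ}

theorem integrable_stopLoss [IsFiniteMeasure μ] (hζ : Integrable ζ μ) (a : ℝ) :
    Integrable (fun ω => max (ζ ω - a) 0) μ :=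
  (hζ.sub (integrable_const a)).pos_part

/-- The mean of `ζ` bounds every member from below, since `1 / (1 - α) ≥ 1`. Boundedness makes the
real infimum in `AVaR` a genuine one. -/
theorem bddBelow_range_avar [IsProbabilityMeasure μ] (hζ : Integrable ζ μ) {α : ℝ}
    (hα : α ∈ Set.Ioo (0 : ℝ) 1) :
    BddBelow (Set.range fun a : ℝ => a + 1 / (1 - α) * ∫ ω, max (ζ ω - a) 0 ∂μ) := by
  refine ⟨min 0 (∫ ω, ζ ω ∂μ), ?_⟩
  rintro _ ⟨a, rfl⟩
  have h0 : 0 ≤ ∫ ω, max (ζ ω - a) 0 ∂μ := integral_nonneg fun _ => le_max_right _ _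
  have h1 : (∫ ω, ζ ω ∂μ) - a ≤ ∫ ω, max (ζ ω - a) 0 ∂μ := by
    have : (∫ ω, ζ ω ∂μ) - a = ∫ ω, (ζ ω - a) ∂μ := by
      rw [integral_sub hζ (integrable_const a)]; simp
    rw [this]
    exact integral_mono (hζ.sub (integrable_const a)) (integrable_stopLoss hζ a)
      fun _ => le_max_left _ _
  have h2 : 1 ≤ 1 / (1 - α) := by
    rw [le_div_iff₀ (by linarith [hα.2])]
    linarith [hα.1]
  have h3 : ∫ ω, max (ζ ω - a) 0 ∂μ ≤ 1 / (1 - α) * ∫ ω, max (ζ ω - a) 0 ∂μ :=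
    le_mul_of_one_le_left h0 h2
  refine (min_le_right _ _).trans ?_
  dsimp only
  linarith

theorem avar_mono_of_stopLoss_le [IsProbabilityMeasure ν] {g : Ω' → ℝ} (hg : Integrable g ν)
    (h : ∀ a : ℝ, ∫ ω, max (g ω - a) 0 ∂ν ≤ ∫ ω, max (ζ ω - a) 0 ∂μ) {α : ℝ}
    (hα : α ∈ Set.Ioo (0 : ℝ) 1) : AVaR ν α g ≤ AVaR μ α ζ := by
  refine ciInf_mono (bddBelow_range_avar hg hα) fun a => ?_
  have : 0 ≤ 1 / (1 - α) := by
    have := hα.2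
    exact one_div_nonneg.2 (by linarith)
  gcongr
  exact h a

/-- At level `1 - P(ζ > a)` the point `a` minimizes the expression defining AVaR. This follows by
integrating the pointwise bound `(ζ - b)₊ ≥ (ζ - a)₊ + (a - b) 1_{ζ > a}`. -/
theorem le_avar_at_quantile [IsProbabilityMeasure μ] (hζ : Integrable ζ μ) (a : ℝ)
    (h0 : μ.real {ω | a < ζ ω} ≠ 0) :
    a + 1 / μ.real {ω | a < ζ ω} * ∫ ω, max (ζ ω - a) 0 ∂μ ≤
      AVaR μ (1 - μ.real {ω | a < ζ ω}) ζ := by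
  set δ := μ.real {ω | a < ζ ω} with hδ
  have hδ0 : 0 < δ := lt_of_le_of_ne measureReal_nonneg h0.symm
  refine le_ciInf fun b => ?_
  have hms : NullMeasurableSet {ω | a < ζ ω} μ :=
    nullMeasurableSet_lt aemeasurable_const hζ.aemeasurable
  have h1 : (∫ ω, max (ζ ω - a) 0 ∂μ) + (a - b) * δ ≤ ∫ ω, max (ζ ω - b) 0 ∂μ := by
    have h2 : (a - b) * δ = ∫ ω, {ω | a < ζ ω}.indicator (fun _ => a - b) ω ∂μ := by
      rw [integral_indicator₀ hms, setIntegral_const, smul_eq_mul, mul_comm]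
    rw [h2, ← integral_add (integrable_stopLoss hζ a)
      ((integrable_const _).indicator₀ hms)]
    refine integral_mono ((integrable_stopLoss hζ a).add
      ((integrable_const _).indicator₀ hms)) (integrable_stopLoss hζ b) fun ω => ?_
    by_cases hω : a < ζ ω
    · simp only [Set.indicator_of_mem (show ω ∈ {ω | a < ζ ω} from hω)]
      rw [max_eq_left (by linarith)]
      refine le_trans (le_of_eq ?_) (le_max_left _ _)
      ring
    · simp only [Set.indicator_of_notMem (show ω ∉ {ω | a < ζ ω} from hω)]
      rw [max_eq_right (by linarith), add_zero]
      exact le_max_right _ _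
  have h3 : 1 - (1 - δ) = δ := by ring
  rw [h3]
  have h4 := mul_le_mul_of_nonneg_left h1 (one_div_nonneg.2 hδ0.le)
  have h5 : 1 / δ * ((∫ ω, max (ζ ω - a) 0 ∂μ) + (a - b) * δ) =
      1 / δ * (∫ ω, max (ζ ω - a) 0 ∂μ) + (a - b) := by
    field_simp
  linarith

theorem setIntegral_sub_le_stopLoss (hσ : IsDistortion σ) (a : ℝ) {α : ℝ}
    (hα : α ∈ Set.Icc (0 : ℝ) 1) :
    (∫ u in Set.Ico α 1, σ u) - (1 - α) * a ≤ ∫ u in Set.Ico (0 : ℝ) 1, max (σ u - a) 0 := by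
  have hi : IntegrableOn σ (Set.Ico α 1) :=
    hσ.integrableOn.mono_set (Set.Ico_subset_Ico_left hα.1)
  have h1 : (∫ u in Set.Ico α 1, σ u) - (1 - α) * a = ∫ u in Set.Ico α 1, (σ u - a) := by
    rw [integral_sub hi (by simp)]
    simp [hα.2]
  rw [h1]
  calc ∫ u in Set.Ico α 1, (σ u - a) ≤ ∫ u in Set.Ico α 1, max (σ u - a) 0 :=
        integral_mono (hi.sub (by simp)) (integrable_stopLoss hi a) fun _ => le_max_left _ _
    _ ≤ _ := setIntegral_mono_set (integrable_stopLoss hσ.integrableOn a)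
        (ae_of_all _ fun _ => le_max_right _ _) (Set.Ico_subset_Ico_left hα.1).eventuallyLE

/-- With `δ = P(ζ > a)` and AVaR level `1 - δ`, feasibility gives `δ a + E(ζ - a)₊ ≤ ∫ σ` over `[1 -
δ, 1)`, and this integral is at most `δ a + ∫ (σ - a)₊`. -/
theorem IsFeasibleDensity.stopLoss_le [IsProbabilityMeasure μ] (hσ : IsDistortion σ)
    (h : IsFeasibleDensity μ σ ζ) (a : ℝ) :
    ∫ ω, max (ζ ω - a) 0 ∂μ ≤ ∫ u in Set.Ico (0 : ℝ) 1, max (σ u - a) 0 := by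
  set δ := μ.real {ω | a < ζ ω} with hδ
  rcases eq_or_ne δ 0 with h0 | h0
  · have h1 : ∫ ω, max (ζ ω - a) 0 ∂μ = 0 := by
      rw [hδ, measureReal_eq_zero_iff] at h0
      refine integral_eq_zero_of_ae ?_
      have : ∀ᵐ ω ∂μ, ¬ a < ζ ω := by
        rw [ae_iff]; simpa using h0
      filter_upwards [this] with ω hω
      exact max_eq_right (by linarith)
    rw [h1]
    exact integral_nonneg fun _ => le_max_right _ _
  have hδ0 : 0 < δ := lt_of_le_of_ne measureReal_nonneg h0.symm
  rcases eq_or_ne δ 1 with h1 | h1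
  -- The level would be `0`, which the constraint does not cover. Here `(ζ - a)₊ = ζ - a` almost
  -- surely, and `ζ` and `σ` have the same mean.
  · have hae : ∀ᵐ ω ∂μ, a < ζ ω := by
      have hms : NullMeasurableSet {ω | a < ζ ω} μ :=
        nullMeasurableSet_lt aemeasurable_const h.integrable.aemeasurable
      rw [ae_iff]
      refine (prob_compl_eq_zero_iff₀ hms).2 ?_
      have := (ENNReal.toReal_eq_one_iff _).1 h1
      exact this
    have h2 : ∫ ω, max (ζ ω - a) 0 ∂μ = ∫ ω, (ζ ω - a) ∂μ := by
      refine integral_congr_ae ?_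
      filter_upwards [hae] with ω hω
      exact max_eq_left (by linarith)
    rw [h2, integral_sub h.integrable (integrable_const a), h.integral_eq_one]
    have := setIntegral_sub_le_stopLoss hσ a (Set.left_mem_Icc.2 zero_le_one)
    rw [hσ.integral_eq_one] at this
    simpa using this
  · have hδ1 : δ < 1 := lt_of_le_of_ne measureReal_le_one h1
    have hα : 1 - δ ∈ Set.Ioo (0 : ℝ) 1 := ⟨by linarith, by linarith⟩
    have h2 := (le_avar_at_quantile h.integrable a h0).trans (h.avar_le _ hα)
    have h3 := setIntegral_sub_le_stopLoss hσ a (Set.Ioo_subset_Icc_self hα)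
    rw [← hδ, sub_sub_cancel] at h2
    rw [sub_sub_cancel] at h3
    have h4 := mul_le_mul_of_nonneg_left h2 hδ0.le
    rw [mul_add, ← mul_assoc, ← mul_assoc, mul_one_div_cancel h0, one_mul, one_mul] at h4
    linarith

theorem lintegral_ofReal_stopLoss [IsFiniteMeasure μ] (hζ : Integrable ζ μ) (a : ℝ) :
    ∫⁻ ω, ENNReal.ofReal (ζ ω - a) ∂μ = ENNReal.ofReal (∫ ω, max (ζ ω - a) 0 ∂μ) := by
  rw [ofReal_integral_eq_lintegral_ofReal (integrable_stopLoss hζ a)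
    (ae_of_all _ fun _ => le_max_right _ _)]
  exact lintegral_congr fun ω => by simp [ENNReal.ofReal_max]

/-- The `L^s`-norm of a density that is feasible for `σ` is at most the norm of `σ`. -/
theorem IsFeasibleDensity.eLpNorm_le [IsProbabilityMeasure μ] (hσ : IsDistortion σ)
    (h : IsFeasibleDensity μ σ ζ) {s : ℝ≥0∞} (hs : 1 < s) :
    eLpNorm ζ s μ ≤ distortionNorm s σ := by
  refine eLpNorm_le_of_stopLoss_le h.integrable.aemeasurable hσ.integrableOn.aemeasurable
    h.nonneg ?_ (fun a => ?_) hs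
  · filter_upwards [ae_restrict_mem measurableSet_Ico] with u hu using hσ.nonneg u hu
  · rw [lintegral_ofReal_stopLoss h.integrable, lintegral_ofReal_stopLoss hσ.integrableOn]
    exact ENNReal.ofReal_le_ofReal (h.stopLoss_le hσ a)

/-- Shows that the supremum defining the risk functional is over a non-empty set. Taking `a = 1` in
the AVaR infimum reduces the constraint to the mean of `σ` over `[α, 1)` being at least one. -/
theorem isFeasibleDensity_one [IsProbabilityMeasure μ] (hσ : IsDistortion σ) :
    IsFeasibleDensity μ σ fun _ => 1 where
  nonneg := ae_of_all _ fun _ => zero_le_one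
  integrable := integrable_const 1
  integral_eq_one := by simp
  avar_le α hα := by
    refine (ciInf_le (bddBelow_range_avar (integrable_const 1) hα) 1).trans ?_
    have h1 : 0 < 1 - α := by linarith [hα.2]
    have := mul_le_mul_of_nonneg_left (hσ.one_sub_le_setIntegral hα) (one_div_nonneg.2 h1.le)
    rw [one_div_mul_cancel h1.ne'] at this
    simpa using this

/-- Averaging a feasible density along a coupling yields a feasible density for the other
marginal. -/
theorem IsFeasibleDensity.exists_transfer [IsProbabilityMeasure μ] [IsProbabilityMeasure ν]
    (h : IsFeasibleDensity μ σ ζ) {π : Measure (Ω × Ω')} (h1 : π.fst = μ) (h2 : π.snd = ν) :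
    ∃ ζ' : Ω' → ℝ, IsFeasibleDensity ν σ ζ' ∧ ∀ Z : Ω' → ℝ, AEStronglyMeasurable Z ν →
      ∫ v, Z v * ζ' v ∂ν = ∫ z, Z z.2 * ζ z.1 ∂π := by
  have hπ : IsProbabilityMeasure π := ⟨by rw [← Measure.fst_univ, h1]; exact measure_univ⟩
  have hmf : MeasurePreserving (Prod.fst : Ω × Ω' → Ω) π μ := ⟨measurable_fst, h1⟩
  have hms : MeasurePreserving (Prod.snd : Ω × Ω' → Ω') π ν := ⟨measurable_snd, h2⟩
  have hζi : Integrable (fun z : Ω × Ω' => ζ z.1) π :=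
    hmf.integrable_comp_of_integrable h.integrable
  have hζ0 : ∀ᵐ z ∂π, 0 ≤ ζ z.1 := hmf.quasiMeasurePreserving.ae h.nonneg
  have hζm : AEMeasurable (fun z : Ω × Ω' => ENNReal.ofReal (ζ z.1)) π :=
    hζi.aemeasurable.ennreal_ofReal
  -- The transferred density is that of the second marginal of `ζ π` with respect to `ν`, that is,
  -- the conditional expectation of `ζ` given the second coordinate.
  set τ : Measure (Ω × Ω') := π.withDensity fun z => ENNReal.ofReal (ζ z.1) with hτ
  have hτf : IsFiniteMeasure τ := isFiniteMeasure_withDensity_ofReal hζi.hasFiniteIntegral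
  have hτν : τ.snd ≪ ν := by
    rw [← h2]
    exact (withDensity_absolutelyContinuous _ _).map measurable_snd
  have key : ∀ Z : Ω' → ℝ, AEStronglyMeasurable Z ν →
      ∫ v, Z v * (τ.snd.rnDeriv ν v).toReal ∂ν = ∫ z, Z z.2 * ζ z.1 ∂π := by
    intro Z hZ
    calc ∫ v, Z v * (τ.snd.rnDeriv ν v).toReal ∂ν
        = ∫ v, Z v ∂τ.snd := by
          exact (integral_congr_ae (ae_of_all _ fun v => mul_comm _ _)).trans
            (integral_toReal_rnDeriv_mul hτν)
      _ = ∫ z, Z z.2 ∂τ := by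
          exact integral_map measurable_snd.aemeasurable (hZ.mono_ac hτν)
      _ = ∫ z, Z z.2 * ζ z.1 ∂π := by
          rw [integral_withDensity_eq_integral_toReal_smul₀ hζm
            (ae_of_all _ fun _ => ENNReal.ofReal_lt_top)]
          refine integral_congr_ae ?_
          filter_upwards [hζ0] with z hz
          rw [ENNReal.toReal_ofReal hz, smul_eq_mul, mul_comm]
  have hgi : Integrable (fun v => (τ.snd.rnDeriv ν v).toReal) ν := Measure.integrable_toReal_rnDeriv
  refine ⟨fun v => (τ.snd.rnDeriv ν v).toReal, ⟨ae_of_all _ fun _ => ENNReal.toReal_nonneg, hgi,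
    ?_, fun α hα => (avar_mono_of_stopLoss_le hgi (fun a => ?_) hα).trans (h.avar_le α hα)⟩, key⟩
  · have := key (fun _ => 1) aestronglyMeasurable_const
    simp only [one_mul] at this
    rw [this, hmf.integral_comp_of_aestronglyMeasurable h.integrable.aestronglyMeasurable]
    exact h.integral_eq_one
  · set g : Ω' → ℝ := fun v => (τ.snd.rnDeriv ν v).toReal with hg
    have hgm : Measurable g := (Measure.measurable_rnDeriv _ _).ennreal_toReal
    -- Conditional Jensen by hand: `E_ν(g - a)₊ = E_π[1_A (ζ - a)] ≤ E_π(ζ - a)₊`, where `1_A`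
    -- depends on the second coordinate only.
    set A : Set Ω' := {v | a < g v} with hA
    have hAm : MeasurableSet A := measurableSet_lt measurable_const hgm
    have hind : Integrable (A.indicator fun _ => (1 : ℝ)) ν := (integrable_const 1).indicator hAm
    have e1 : ∫ v, max (g v - a) 0 ∂ν =
        (∫ v, A.indicator (fun _ => (1 : ℝ)) v * g v ∂ν) - a * ∫ v, A.indicator (fun _ => 1) v ∂ν := by
      rw [← integral_const_mul, ← integral_sub]
      · refine integral_congr_ae (ae_of_all _ fun v => ?_)
        by_cases hv : v ∈ A
        · simp only [Set.indicator_of_mem hv, one_mul, mul_one]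
          exact max_eq_left (sub_nonneg.2 (le_of_lt hv))
        · simp only [Set.indicator_of_notMem hv, zero_mul, mul_zero, sub_zero]
          exact max_eq_right (sub_nonpos.2 (not_lt.1 hv))
      · refine (hgi.indicator hAm).congr (ae_of_all _ fun v => ?_)
        by_cases hv : v ∈ A <;> simp [hv]
      · exact hind.const_mul a
    have hindπ : Integrable (fun z : Ω × Ω' => A.indicator (fun _ => (1 : ℝ)) z.2) π :=
      hms.integrable_comp_of_integrable hind
    have hprod : Integrable (fun z : Ω × Ω' => A.indicator (fun _ => (1 : ℝ)) z.2 * ζ z.1) π := by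
      refine (hζi.indicator (measurable_snd hAm)).congr (ae_of_all _ fun z => ?_)
      by_cases hv : z.2 ∈ A <;> simp [Set.indicator, hv]
    have e2 : ∫ v, A.indicator (fun _ => (1 : ℝ)) v ∂ν =
        ∫ z, A.indicator (fun _ => (1 : ℝ)) z.2 ∂π :=
      (hms.integral_comp_of_aestronglyMeasurable hind.aestronglyMeasurable).symm
    have e3 : ∫ ω, max (ζ ω - a) 0 ∂μ = ∫ z, max (ζ z.1 - a) 0 ∂π :=
      (hmf.integral_comp_of_aestronglyMeasurable
        (integrable_stopLoss h.integrable a).aestronglyMeasurable).symm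
    rw [e1, key _ hind.aestronglyMeasurable, e2, e3, ← integral_const_mul,
      ← integral_sub hprod (hindπ.const_mul a)]
    refine integral_mono (hprod.sub (hindπ.const_mul a)) (integrable_stopLoss hζi a) fun z => ?_
    by_cases hv : z.2 ∈ A
    · simp only [Set.indicator_of_mem hv, one_mul, mul_one]
      exact le_max_left _ _
    · simp only [Set.indicator_of_notMem hv, zero_mul, mul_zero, sub_zero]
      exact le_max_right _ _

end Density

/-! ### Stability of the risk functional under couplings -/

/-- A non-empty collection of distortion functions that is bounded in `L^s([0,1))`. -/
structure IsBoundedDistortionFamily (s : ℝ≥0∞) (M : ℝ≥0∞) (S : Set (ℝ → ℝ)) : Prop where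
  nonempty : S.Nonempty
  isDistortion : ∀ σ ∈ S, IsDistortion σ
  norm_le : ∀ σ ∈ S, distortionNorm s σ ≤ M

section Stability

variable {Ω Ω' : Type*} [MeasurableSpace Ω] [MeasurableSpace Ω'] {μ : Measure Ω} {ν : Measure Ω'}
  {S : Set (ℝ → ℝ)} {p p' s s' M K : ℝ≥0∞}

theorem IsFeasibleDensity.memLp [IsProbabilityMeasure μ] {σ : ℝ → ℝ} {ζ : Ω → ℝ}
    (hS : IsBoundedDistortionFamily s M S) (hs : 1 < s) (hM : M ≠ ∞) (hσ : σ ∈ S)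
    (h : IsFeasibleDensity μ σ ζ) : MemLp ζ s μ :=
  ⟨h.integrable.aestronglyMeasurable,
    (h.eLpNorm_le (hS.isDistortion σ hσ) hs).trans_lt ((hS.norm_le σ hσ).trans_lt hM.lt_top)⟩

theorem enorm_integral_mul_le (hss : s.HolderConjugate s') {f g : Ω → ℝ}
    (hf : AEStronglyMeasurable f μ) (hg : AEStronglyMeasurable g μ) :
    ‖∫ ω, f ω * g ω ∂μ‖ₑ ≤ eLpNorm g s' μ * eLpNorm f s μ := by
  refine (enorm_integral_le_lintegral_enorm _).trans ?_
  rw [← eLpNorm_one_eq_lintegral_enorm, mul_comm]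
  have h := eLpNorm_smul_le_mul_eLpNorm (r := 1) hg hf (hpqr := hss)
  simpa only [smul_eq_mul] using! h

theorem bddAbove_riskFunctional [IsProbabilityMeasure μ] (hpp : p.HolderConjugate p')
    (hp' : 1 < p') (hS : IsBoundedDistortionFamily p' M S) (hM : M ≠ ∞) {Y : Ω → ℝ}
    (hY : MemLp Y p μ) :
    BddAbove {e : ℝ | ∃ σ ∈ S, ∃ ζ : Ω → ℝ, IsFeasibleDensity μ σ ζ ∧ e = ∫ ω, Y ω * ζ ω ∂μ} := by
  refine ⟨(M * eLpNorm Y p μ).toReal, ?_⟩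
  rintro _ ⟨σ, hσ, ζ, hζ, rfl⟩
  have h1 : ‖∫ ω, Y ω * ζ ω ∂μ‖ₑ ≤ M * eLpNorm Y p μ := by
    refine (enorm_integral_mul_le hpp hY.1 hζ.integrable.aestronglyMeasurable).trans ?_
    gcongr
    exact (hζ.eLpNorm_le (hS.isDistortion σ hσ) hp').trans (hS.norm_le σ hσ)
  have h2 := ENNReal.toReal_mono (ENNReal.mul_ne_top hM hY.2.ne) h1
  rw [toReal_enorm] at h2
  exact (le_abs_self _).trans h2

/-- A density feasible under `μ` is transferred along `π`; the two objectives differ by `E_π[(Y - Z)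
ζ]`, to which Hölder applies. The pair `(p, p')` only secures integrability and bounded suprema,
while `(s, s')` produces the estimate. -/
theorem riskFunctional_sub_le [IsProbabilityMeasure μ] [IsProbabilityMeasure ν]
    (hpp : p.HolderConjugate p') (hp' : 1 < p') (hS : IsBoundedDistortionFamily p' M S)
    (hM : M ≠ ∞) (hss : s.HolderConjugate s') (hs' : 1 < s')
    (hS' : IsBoundedDistortionFamily s' K S) {Y : Ω → ℝ} {Z : Ω' → ℝ} (hY : MemLp Y p μ)
    (hZ : MemLp Z p ν) {π : Measure (Ω × Ω')} (h1 : π.fst = μ) (h2 : π.snd = ν)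
    (hfin : K * eLpNorm (fun z => Y z.1 - Z z.2) s π ≠ ∞) :
    riskFunctional S μ Y - riskFunctional S ν Z ≤
      (K * eLpNorm (fun z => Y z.1 - Z z.2) s π).toReal := by
  have hmf : MeasurePreserving (Prod.fst : Ω × Ω' → Ω) π μ := ⟨measurable_fst, h1⟩
  have hms : MeasurePreserving (Prod.snd : Ω × Ω' → Ω') π ν := ⟨measurable_snd, h2⟩
  rw [sub_le_iff_le_add]
  refine csSup_le ?_ ?_
  · obtain ⟨σ, hσ⟩ := hS.nonempty
    exact ⟨_, σ, hσ, _, isFeasibleDensity_one (hS.isDistortion σ hσ), rfl⟩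
  rintro _ ⟨σ, hσ, ζ, hζ, rfl⟩
  obtain ⟨ζ', hζ', hint⟩ := hζ.exists_transfer h1 h2
  have hle : ∫ v, Z v * ζ' v ∂ν ≤ riskFunctional S ν Z :=
    le_csSup (bddAbove_riskFunctional hpp hp' hS hM hZ) ⟨σ, hσ, ζ', hζ', rfl⟩
  have hζp : MemLp (fun z : Ω × Ω' => ζ z.1) p' π :=
    (hζ.memLp hS hp' hM hσ).comp_measurePreserving hmf
  have hYπ : MemLp (fun z : Ω × Ω' => Y z.1) p π := hY.comp_measurePreserving hmf
  have hZπ : MemLp (fun z : Ω × Ω' => Z z.2) p π := hZ.comp_measurePreserving hms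
  have hdiff : (∫ ω, Y ω * ζ ω ∂μ) - ∫ v, Z v * ζ' v ∂ν =
      ∫ z, (Y z.1 - Z z.2) * ζ z.1 ∂π := by
    rw [hint Z hZ.1, ← hmf.integral_comp_of_aestronglyMeasurable (g := fun ω => Y ω * ζ ω)
      (hY.1.mul hζ.integrable.aestronglyMeasurable), ← integral_sub]
    · simp_rw [sub_mul]
    · exact hYπ.integrable_mul hζp
    · exact hZπ.integrable_mul hζp
  have hbound : ‖∫ z, (Y z.1 - Z z.2) * ζ z.1 ∂π‖ₑ ≤
      K * eLpNorm (fun z => Y z.1 - Z z.2) s π := by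
    refine (enorm_integral_mul_le (f := fun z => Y z.1 - Z z.2) hss (hYπ.1.sub hZπ.1)
      hζp.1).trans ?_
    gcongr
    refine le_trans (le_of_eq ?_)
      ((hζ.eLpNorm_le (hS.isDistortion σ hσ) hs').trans (hS'.norm_le σ hσ))
    exact eLpNorm_comp_measurePreserving hζ.integrable.aestronglyMeasurable hmf
  have h3 := ENNReal.toReal_mono hfin hbound
  rw [toReal_enorm] at h3
  have h4 := (le_abs_self _).trans h3
  linarith

/-- Risk functionals are Lipschitz with respect to the `L^s`-distance along any coupling. -/
theorem enorm_riskFunctional_sub_le [IsProbabilityMeasure μ] [IsProbabilityMeasure ν]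
    (hpp : p.HolderConjugate p') (hp' : 1 < p') (hS : IsBoundedDistortionFamily p' M S)
    (hM : M ≠ ∞) (hss : s.HolderConjugate s') (hs' : 1 < s')
    (hS' : IsBoundedDistortionFamily s' K S) {Y : Ω → ℝ} {Z : Ω' → ℝ} (hY : MemLp Y p μ)
    (hZ : MemLp Z p ν) {π : Measure (Ω × Ω')} (h1 : π.fst = μ) (h2 : π.snd = ν) :
    ‖riskFunctional S μ Y - riskFunctional S ν Z‖ₑ ≤
      K * eLpNorm (fun z => Y z.1 - Z z.2) s π := by
  rcases eq_or_ne (K * eLpNorm (fun z => Y z.1 - Z z.2) s π) ∞ with hfin | hfin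
  · rw [hfin]; exact le_top
  have hmf : MeasurePreserving (Prod.fst : Ω × Ω' → Ω) π μ := ⟨measurable_fst, h1⟩
  have hms : MeasurePreserving (Prod.snd : Ω × Ω' → Ω') π ν := ⟨measurable_snd, h2⟩
  -- The reverse inequality comes from the swapped coupling, which has the same `L^s`-distance.
  have hswap : eLpNorm (fun z : Ω' × Ω => Z z.1 - Y z.2) s (π.map Prod.swap) =
      eLpNorm (fun z => Y z.1 - Z z.2) s π := by
    rw [← eLpNorm_neg (f := fun z : Ω × Ω' => Y z.1 - Z z.2)]
    have hms' : MeasurePreserving (Prod.swap : Ω × Ω' → Ω' × Ω) π (π.map Prod.swap) :=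
      ⟨measurable_swap, rfl⟩
    have hm1 : MeasurePreserving (Prod.fst : Ω' × Ω → Ω') (π.map Prod.swap) ν :=
      ⟨measurable_fst, by rw [← h2, ← Measure.fst_map_swap]; rfl⟩
    have hm2 : MeasurePreserving (Prod.snd : Ω' × Ω → Ω) (π.map Prod.swap) μ :=
      ⟨measurable_snd, by rw [← h1, ← Measure.snd_map_swap]; rfl⟩
    rw [← eLpNorm_comp_measurePreserving (g := fun z : Ω' × Ω => Z z.1 - Y z.2)
      ((hZ.1.comp_measurePreserving hm1).sub (hY.1.comp_measurePreserving hm2)) hms']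
    congr 1
    ext z
    simp
  rw [Real.enorm_eq_ofReal_abs]
  refine ENNReal.ofReal_le_of_le_toReal (abs_sub_le_iff.2 ⟨?_, ?_⟩)
  · exact riskFunctional_sub_le hpp hp' hS hM hss hs' hS' hY hZ h1 h2 hfin
  · rw [← hswap] at hfin ⊢
    exact riskFunctional_sub_le hpp hp' hS hM hss hs' hS' hZ hY
      (by rw [Measure.fst_map_swap, h2]) (by rw [Measure.snd_map_swap, h1]) hfin

theorem enorm_riskFunctional_sub_le_eLpNorm_sub [IsProbabilityMeasure μ]
    (hpp : p.HolderConjugate p') (hp' : 1 < p') (hS : IsBoundedDistortionFamily p' M S)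
    (hM : M ≠ ∞) {Y Z : Ω → ℝ} (hY : MemLp Y p μ) (hZ : MemLp Z p μ) :
    ‖riskFunctional S μ Y - riskFunctional S μ Z‖ₑ ≤ M * eLpNorm (Y - Z) p μ := by
  have hd : Measurable fun ω : Ω => (ω, ω) := measurable_id.prodMk measurable_id
  have hm : MeasurePreserving (fun ω : Ω => (ω, ω)) μ (μ.map fun ω => (ω, ω)) := ⟨hd, rfl⟩
  have hf : (μ.map fun ω => (ω, ω)).fst = μ := by
    exact (Measure.fst_map_prodMk (X := id) measurable_id).trans Measure.map_id
  have hs : (μ.map fun ω => (ω, ω)).snd = μ := by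
    exact (Measure.snd_map_prodMk (Y := id) measurable_id).trans Measure.map_id
  refine (enorm_riskFunctional_sub_le hpp hp' hS hM hpp hp' hS hY hZ hf hs).trans (le_of_eq ?_)
  congr 1
  rw [← eLpNorm_comp_measurePreserving _ hm]
  · rfl
  · exact (hY.1.comp_measurePreserving ⟨measurable_fst, hf⟩).sub
      (hZ.1.comp_measurePreserving ⟨measurable_snd, hs⟩)

theorem riskFunctional_congr_ae {Y Z : Ω → ℝ} (h : Y =ᵐ[μ] Z) :
    riskFunctional S μ Y = riskFunctional S μ Z := by
  have : ∀ ζ : Ω → ℝ, ∫ ω, Y ω * ζ ω ∂μ = ∫ ω, Z ω * ζ ω ∂μ := fun ζ =>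
    integral_congr_ae (h.mono fun ω hω => by simp only [hω])
  simp only [riskFunctional, this]

theorem riskFunctional_const [IsProbabilityMeasure μ] (hne : S.Nonempty)
    (hS : ∀ σ ∈ S, IsDistortion σ) (c : ℝ) : riskFunctional S μ (fun _ => c) = c := by
  have : {e : ℝ | ∃ σ ∈ S, ∃ ζ : Ω → ℝ, IsFeasibleDensity μ σ ζ ∧ e = ∫ ω, c * ζ ω ∂μ} = {c} := by
    ext e
    constructor
    · rintro ⟨σ, -, ζ, hζ, rfl⟩
      rw [integral_const_mul, hζ.integral_eq_one, mul_one]; rfl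
    · rintro rfl
      obtain ⟨σ, hσ⟩ := hne
      exact ⟨σ, hσ, _, isFeasibleDensity_one (hS σ hσ), by simp⟩
  rw [riskFunctional, this, csSup_singleton]

theorem enorm_riskFunctional_le [IsProbabilityMeasure μ]
    (hpp : p.HolderConjugate p') (hp' : 1 < p') (hS : IsBoundedDistortionFamily p' M S)
    (hM : M ≠ ∞) {Y : Ω → ℝ} (hY : MemLp Y p μ) :
    ‖riskFunctional S μ Y‖ₑ ≤ M * eLpNorm Y p μ := by
  have := enorm_riskFunctional_sub_le_eLpNorm_sub hpp hp' hS hM hY (memLp_const 0)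
  rw [riskFunctional_const hS.nonempty hS.isDistortion, sub_zero] at this
  convert this using 3
  ext ω
  simp

/-- Risk functionals are law invariant. -/
theorem riskFunctional_map [IsProbabilityMeasure μ]
    (hpp : p.HolderConjugate p') (hp' : 1 < p') (hS : IsBoundedDistortionFamily p' M S)
    (hM : M ≠ ∞) {f : Ω → Ω'} (hf : Measurable f) {Z : Ω' → ℝ} (hZ : MemLp Z p (μ.map f)) :
    riskFunctional S (μ.map f) Z = riskFunctional S μ (Z ∘ f) := by
  have : IsProbabilityMeasure (μ.map f) := Measure.isProbabilityMeasure_map hf.aemeasurable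
  have hmf : MeasurePreserving f μ (μ.map f) := ⟨hf, rfl⟩
  -- The graph of `f` couples the two measures, and the difference of the two integrands vanishes on
  -- it.
  have hgr : MeasurePreserving (fun ω => (f ω, ω)) μ (μ.map fun ω => (f ω, ω)) :=
    ⟨hf.prodMk measurable_id, rfl⟩
  have h1 : (μ.map fun ω => (f ω, ω)).fst = μ.map f := Measure.fst_map_prodMk measurable_id
  have h2 : (μ.map fun ω => (f ω, ω)).snd = μ := by
    rw [Measure.snd_map_prodMk hf]; exact Measure.map_id
  have hZf : MemLp (Z ∘ f) p μ := hZ.comp_measurePreserving hmf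
  have key := enorm_riskFunctional_sub_le hpp hp' hS hM hpp hp' hS hZ hZf h1 h2
  rw [← eLpNorm_comp_measurePreserving (g := fun z : Ω' × Ω => Z z.1 - (Z ∘ f) z.2)
    ((hZ.1.comp_measurePreserving ⟨measurable_fst, h1⟩).sub
      (hZf.1.comp_measurePreserving ⟨measurable_snd, h2⟩)) hgr] at key
  have h0 : ((fun z : Ω' × Ω => Z z.1 - (Z ∘ f) z.2) ∘ fun ω => (f ω, ω)) = 0 := by
    ext ω; simp
  rw [h0, eLpNorm_zero, mul_zero, nonpos_iff_eq_zero, enorm_eq_zero, sub_eq_zero] at key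
  exact key

end Stability

/-! ### Measurability of conditional risk functionals -/

section Finite

variable {F : Type*} [Fintype F] [MeasurableSpace F] [MeasurableSingletonClass F]

open Classical in
/-- A coupling of two laws on a finite set with small mass off the diagonal. -/
theorem exists_coupling_measure_ne_le (ν ν' : Measure F) [IsProbabilityMeasure ν]
    [IsProbabilityMeasure ν'] :
    ∃ π : Measure (F × F), π.fst = ν ∧ π.snd = ν' ∧
      π {z | z.1 ≠ z.2} ≤ ∑ i, (ν {i} - ν' {i}) := by
  set l : Measure F := ∑ i, (min (ν {i}) (ν' {i})) • Measure.dirac i with hl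
  set α : Measure F := ∑ i, (ν {i} - ν' {i}) • Measure.dirac i with hα
  set α' : Measure F := ∑ i, (ν' {i} - ν {i}) • Measure.dirac i with hα'
  have hsingle : ∀ (w : F → ℝ≥0∞) (j : F),
      (∑ i, w i • Measure.dirac i : Measure F) {j} = w j := by
    intro w j
    simp [Measure.finsetSum_apply, Set.indicator_apply]
  have huniv : ∀ w : F → ℝ≥0∞, (∑ i, w i • Measure.dirac i : Measure F) Set.univ = ∑ i, w i := by
    intro w
    simp [Measure.finsetSum_apply]
  have hν : l + α = ν := by
    refine Measure.ext_iff_singleton.2 fun j => ?_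
    rw [Measure.add_apply, hl, hα, hsingle, hsingle]
    rcases le_total (ν {j}) (ν' {j}) with h | h
    · rw [min_eq_left h, tsub_eq_zero_of_le h, add_zero]
    · rw [min_eq_right h, add_tsub_cancel_of_le h]
  have hν' : l + α' = ν' := by
    refine Measure.ext_iff_singleton.2 fun j => ?_
    rw [Measure.add_apply, hl, hα', hsingle, hsingle]
    rcases le_total (ν {j}) (ν' {j}) with h | h
    · rw [min_eq_left h, add_tsub_cancel_of_le h]
    · rw [min_eq_right h, tsub_eq_zero_of_le h, add_zero]
  have h1 : l Set.univ + α Set.univ = 1 := by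
    rw [← Measure.add_apply, hν, measure_univ]
  have h2 : l Set.univ + α' Set.univ = 1 := by
    rw [← Measure.add_apply, hν', measure_univ]
  have hltop : l Set.univ ≠ ∞ := ne_top_of_le_ne_top ENNReal.one_ne_top (h1 ▸ le_self_add)
  have hαtop : α Set.univ ≠ ∞ := ne_top_of_le_ne_top ENNReal.one_ne_top (h1 ▸ le_add_self)
  have hαα' : α' Set.univ = α Set.univ := (ENNReal.add_right_inj hltop).1 (h2.trans h1.symm)
  have : IsFiniteMeasure α := ⟨hαtop.lt_top⟩
  have : IsFiniteMeasure α' := ⟨by rw [hαα']; exact hαtop.lt_top⟩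
  -- The common part `l` is placed on the diagonal, and the excesses `α` and `α'`, of equal mass,
  -- are coupled by their normalized product. If that mass is `0`, the factor `0⁻¹ = ∞` is harmless
  -- because it multiplies the zero measure.
  have hdiag : Measurable fun i : F => (i, i) := measurable_id.prodMk measurable_id
  have hscale : ∀ τ : Measure F, τ Set.univ = α Set.univ →
      ((α Set.univ)⁻¹ * α Set.univ) • τ = τ := by
    intro τ hτ
    rcases eq_or_ne (α Set.univ) 0 with h0 | h0
    · rw [h0] at hτ
      rw [Measure.measure_univ_eq_zero.1 hτ, smul_zero]
    · rw [ENNReal.inv_mul_cancel h0 hαtop, one_smul]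
  refine ⟨l.map (fun i => (i, i)) + (α Set.univ)⁻¹ • α.prod α', ?_, ?_, ?_⟩
  · have h : (l.map fun i => (i, i)).fst = l :=
      (Measure.fst_map_prodMk (X := id) measurable_id).trans Measure.map_id
    rw [Measure.fst_add, h, Measure.fst, Measure.map_smul, Measure.map_fst_prod, smul_smul,
      hαα', hscale α rfl, hν]
  · have h : (l.map fun i => (i, i)).snd = l :=
      (Measure.snd_map_prodMk (Y := id) measurable_id).trans Measure.map_id
    rw [Measure.snd_add, h, Measure.snd, Measure.map_smul, Measure.map_snd_prod, smul_smul,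
      hscale α' hαα', hν']
  · rw [Measure.add_apply, Measure.map_apply hdiag (Set.toFinite _).measurableSet]
    simp only [ne_eq, Set.preimage_ofPred_eq, not_true_eq_false, Set.ofPred_false, measure_empty,
      zero_add]
    rw [← huniv, ← hα]
    refine (measure_mono (Set.subset_univ _)).trans ?_
    rw [Measure.smul_apply, smul_eq_mul, ← Set.univ_prod_univ, Measure.prod_prod, hαα', ← mul_assoc]
    exact mul_le_of_le_one_left zero_le (ENNReal.inv_mul_le_one _)

theorem enorm_riskFunctional_sub_le_of_finite {S : Set (ℝ → ℝ)} {p p' M : ℝ≥0∞}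
    (hpp : p.HolderConjugate p') (hp' : 1 < p') (hS : IsBoundedDistortionFamily p' M S)
    (hM : M ≠ ∞) (y : F → ℝ) (ν ν' : Measure F) [IsProbabilityMeasure ν]
    [IsProbabilityMeasure ν'] :
    ‖riskFunctional S ν y - riskFunctional S ν' y‖ₑ ≤
      M * (ENNReal.ofReal (2 * ∑ i, |y i|) * (∑ i, (ν {i} - ν' {i})) ^ (1 / p.toReal)) := by
  obtain ⟨π, h1, h2, h3⟩ := exists_coupling_measure_ne_le ν ν'
  have hy : ∀ (τ : Measure F) [IsProbabilityMeasure τ], MemLp y p τ := fun τ _ =>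
    MemLp.of_bound (measurable_of_finite y).aestronglyMeasurable (∑ i, |y i|)
      (ae_of_all _ fun i => Finset.single_le_sum (f := fun i => |y i|)
        (fun _ _ => abs_nonneg _) (Finset.mem_univ i))
  refine (enorm_riskFunctional_sub_le hpp hp' hS hM hpp hp' hS (hy ν) (hy ν') h1 h2).trans ?_
  gcongr
  have h4 : eLpNorm (fun z : F × F => y z.1 - y z.2) p π ≤
      eLpNorm ({z : F × F | z.1 ≠ z.2}.indicator fun _ => 2 * ∑ i, |y i|) p π := by
    refine eLpNorm_mono fun z => ?_
    by_cases hz : z.1 = z.2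
    · simp [hz]
    · rw [Set.indicator_of_mem (show z ∈ {z : F × F | z.1 ≠ z.2} from hz)]
      have hb : ∀ i, |y i| ≤ ∑ i, |y i| := fun i => Finset.single_le_sum (f := fun i => |y i|)
        (fun _ _ => abs_nonneg _) (Finset.mem_univ i)
      have h5 := abs_sub (y z.1) (y z.2)
      rw [Real.norm_eq_abs, Real.norm_eq_abs]
      refine le_trans ?_ (le_abs_self _)
      linarith [hb z.1, hb z.2]
  refine h4.trans ((eLpNorm_indicator_const_le _ _).trans ?_)
  rw [Real.enorm_of_nonneg (mul_nonneg zero_le_two (Finset.sum_nonneg fun _ _ => abs_nonneg _))]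
  gcongr

end Finite

/-- A function that is continuous as a function of finitely many measurable parameters is
measurable. -/
theorem measurable_of_tendsto_of_measurable {X E : Type*} [MeasurableSpace X] [TopologicalSpace E]
    [MeasurableSpace E] [BorelSpace E] {w : X → E} (hw : Measurable w) {f : X → ℝ}
    (B : E → E → ℝ≥0∞) (hB : ∀ e, Filter.Tendsto (fun e' => B e' e) (nhds e) (nhds 0))
    (hf : ∀ x x', ‖f x - f x'‖ₑ ≤ B (w x) (w x')) : Measurable f := by
  -- The function factors through the range of `w` by a choice of preimages. The choice is
  -- immaterial because `hB` forces `B e e = 0`.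
  have hcont : Continuous fun e : Set.range w => f e.2.choose := by
    refine continuous_iff_continuousAt.2 fun e => tendsto_iff_edist_tendsto_0.2 ?_
    refine tendsto_of_tendsto_of_tendsto_of_le_of_le tendsto_const_nhds
      ((hB e).comp continuous_subtype_val.continuousAt) (fun _ => zero_le) fun e' => ?_
    have := hf e'.2.choose e.2.choose
    rw [e'.2.choose_spec, e.2.choose_spec] at this
    rwa [edist_eq_enorm_sub]
  have hfw : f = (fun e : Set.range w => f e.2.choose) ∘ fun x => ⟨w x, x, rfl⟩ := by
    ext x
    have hx : ∃ x', w x' = w x := ⟨x, rfl⟩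
    have h1 := hf x hx.choose
    have h2 : B (w x) (w x) = 0 :=
      tendsto_nhds_unique (tendsto_pure_nhds (fun e => B e (w x)) (w x))
        ((hB (w x)).mono_left (pure_le_nhds _))
    rw [hx.choose_spec, h2, nonpos_iff_eq_zero, enorm_eq_zero, sub_eq_zero] at h1
    exact h1
  rw [hfw]
  exact hcont.measurable.comp hw.subtype_mk

theorem lintegral_rpow_enorm_congr_ae {Ω : Type*} [MeasurableSpace Ω] {μ : Measure Ω} {f g : Ω → ℝ}
    (h : ∀ᵐ ω ∂μ, f ω = g ω) {t : ℝ} : ∫⁻ ω, ‖f ω‖ₑ ^ t ∂μ = ∫⁻ ω, ‖g ω‖ₑ ^ t ∂μ :=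
  lintegral_congr_ae (h.mono fun ω hω => by simp only [hω])

section Kernel

variable {X Ω : Type*} [MeasurableSpace X] [MeasurableSpace Ω] {κ : Kernel X Ω} [IsMarkovKernel κ]
  {S : Set (ℝ → ℝ)} {p p' M : ℝ≥0∞}

/-- By law invariance only the law of the simple function under `κ x` matters. It is a vector of
finitely many point masses, measurable in `x`, on which the risk functional depends continuously by
the coupling bound. -/
theorem measurable_riskFunctional_simpleFunc (hpp : p.HolderConjugate p') (hp' : 1 < p')
    (hp0 : p ≠ 0) (hp : p ≠ ∞) (hS : IsBoundedDistortionFamily p' M S) (hM : M ≠ ∞)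
    (Z : SimpleFunc (X × Ω) ℝ) :
    Measurable fun x => riskFunctional S (κ x) fun ω => Z (x, ω) := by
  set g : X × Ω → Z.range := fun z => ⟨Z z, Z.mem_range_self z⟩ with hg
  have hgm : Measurable g := Z.measurable.subtype_mk
  have hgx : ∀ x, Measurable fun ω => g (x, ω) := fun x => hgm.comp measurable_prodMk_left
  have hprob : ∀ x, IsProbabilityMeasure ((κ x).map fun ω => g (x, ω)) := fun x =>
    Measure.isProbabilityMeasure_map (hgx x).aemeasurable
  have hmap : ∀ x, riskFunctional S (κ x) (fun ω => Z (x, ω)) =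
      riskFunctional S ((κ x).map fun ω => g (x, ω)) Subtype.val := fun x => by
    refine (riskFunctional_map (μ := κ x) (Z := fun i : Z.range => (i : ℝ)) hpp hp' hS hM
      (hgx x) ?_).symm
    refine MemLp.of_bound measurable_subtype_coe.aestronglyMeasurable (∑ i : Z.range, |(i : ℝ)|)
      (ae_of_all _ fun i => Finset.single_le_sum (f := fun i : Z.range => |(i : ℝ)|)
        (fun _ _ => abs_nonneg _) (Finset.mem_univ i))
  simp_rw [hmap]
  have hp_pos : 0 < 1 / p.toReal := one_div_pos.2 (ENNReal.toReal_pos hp0 hp)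
  refine measurable_of_tendsto_of_measurable
    (w := fun x (i : Z.range) => ((κ x).map fun ω => g (x, ω)) {i}) ?_
    (fun e e' => M * (ENNReal.ofReal (2 * ∑ i : Z.range, |(i : ℝ)|) *
      (∑ i, (e i - e' i)) ^ (1 / p.toReal))) (fun e => ?_)
    (fun x x' => enorm_riskFunctional_sub_le_of_finite hpp hp' hS hM _ _ _)
  · refine measurable_pi_lambda _ fun i => ?_
    have : ∀ x, ((κ x).map fun ω => g (x, ω)) {i} = κ x (Prod.mk x ⁻¹' (g ⁻¹' {i})) := fun x =>
      Measure.map_apply (hgx x) (measurableSet_singleton i)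
    simp_rw [this]
    exact Kernel.measurable_kernel_prodMk_left (hgm (measurableSet_singleton i))
  · have h1 : Filter.Tendsto (fun e' : Z.range → ℝ≥0∞ => ∑ i, (e' i - e i)) (nhds e) (nhds 0) := by
      have : Continuous fun e' : Z.range → ℝ≥0∞ => ∑ i, (e' i - e i) :=
        continuous_finsetSum _ fun i _ =>
          (ENNReal.continuous_sub_right (e i)).comp (continuous_apply i)
      have h2 := this.tendsto e
      simpa only [tsub_self, Finset.sum_const_zero] using h2
    have h2 := (ENNReal.continuous_rpow_const (y := 1 / p.toReal)).tendsto 0 |>.comp h1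
    rw [ENNReal.zero_rpow_of_pos hp_pos] at h2
    have h3 := ENNReal.Tendsto.const_mul (a := M) (ENNReal.Tendsto.const_mul
      (a := ENNReal.ofReal (2 * ∑ i : Z.range, |(i : ℝ)|)) h2 (Or.inr ENNReal.ofReal_ne_top))
      (Or.inr hM)
    simpa only [mul_zero] using! h3

theorem ae_memLp_of_memLp_compProd {m : Measure X} [SFinite m] (hp0 : p ≠ 0) (hp : p ≠ ∞)
    {F : X × Ω → ℝ} (hF : MemLp F p (m ⊗ₘ κ)) :
    ∀ᵐ x ∂m, MemLp (fun ω => F (x, ω)) p (κ x) := by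
  have hfin := lintegral_rpow_enorm_lt_top_of_eLpNorm_lt_top hp0 hp hF.2
  have hmeas := hF.1.stronglyMeasurable_mk.measurable.enorm.pow_const p.toReal
  rw [lintegral_rpow_enorm_congr_ae hF.1.ae_eq_mk,
    Measure.lintegral_compProd hmeas] at hfin
  filter_upwards [ae_lt_top hmeas.lintegral_kernel_prod_right' hfin.ne,
    Measure.ae_ae_of_ae_compProd hF.1.ae_eq_mk, hF.1.compProd_mk_left] with x hx hx' hxm
  refine ⟨hxm, (eLpNorm_lt_top_iff_lintegral_rpow_enorm_lt_top hp0 hp).2 ?_⟩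
  rwa [lintegral_rpow_enorm_congr_ae hx']

/-- On almost every fiber the integrand lies in `L^p`, where simple functions approximate it and the
risk functional is Lipschitz. The conditional risk is thus an almost everywhere limit of measurable
functions. -/
theorem aemeasurable_riskFunctional {m : Measure X} [SFinite m] (hpp : p.HolderConjugate p')
    (hp' : 1 < p') (hp0 : p ≠ 0) (hp : p ≠ ∞) (hS : IsBoundedDistortionFamily p' M S)
    (hM : M ≠ ∞) {F : X × Ω → ℝ} (hF : MemLp F p (m ⊗ₘ κ)) :
    AEMeasurable (fun x => riskFunctional S (κ x) fun ω => F (x, ω)) m := by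
  have hG := hF.1.stronglyMeasurable_mk.measurable
  set G : X × Ω → ℝ := hF.1.mk F with hGdef
  have hGp : MemLp G p (m ⊗ₘ κ) := (memLp_congr_ae hF.1.ae_eq_mk).1 hF
  have hFG : (fun x => riskFunctional S (κ x) fun ω => G (x, ω)) =ᵐ[m]
      fun x => riskFunctional S (κ x) fun ω => F (x, ω) := by
    filter_upwards [Measure.ae_ae_of_ae_compProd hF.1.ae_eq_mk] with x hx
    exact (riskFunctional_congr_ae hx).symm
  refine AEMeasurable.congr ?_ hFG
  set Z : ℕ → SimpleFunc (X × Ω) ℝ := SimpleFunc.approxOn G hG Set.univ 0 (Set.mem_univ 0) with hZ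
  refine aemeasurable_of_tendsto_metrizable_ae Filter.atTop
    (fun n => (measurable_riskFunctional_simpleFunc (κ := κ) hpp hp' hp0 hp hS hM
      (Z n)).aemeasurable) ?_
  filter_upwards [ae_memLp_of_memLp_compProd hp0 hp hGp] with x hx
  have hGx : Measurable fun ω => G (x, ω) := hG.comp measurable_prodMk_left
  have hlim := SimpleFunc.tendsto_approxOn_Lp_eLpNorm hGx (Set.mem_univ (0 : ℝ)) hp (μ := κ x)
    (ae_of_all _ fun ω => by simp) (by simpa using hx.2)
  refine tendsto_iff_edist_tendsto_0.2 ?_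
  have hlim' := ENNReal.Tendsto.const_mul (a := M) hlim (Or.inr hM)
  rw [mul_zero] at hlim'
  refine tendsto_of_tendsto_of_tendsto_of_le_of_le tendsto_const_nhds hlim' (fun _ => zero_le)
    fun n => ?_
  dsimp only
  rw [edist_eq_enorm_sub]
  exact enorm_riskFunctional_sub_le_eLpNorm_sub hpp hp' hS hM
    (SimpleFunc.memLp_approxOn hGx hx (Set.mem_univ 0) (memLp_const 0) n) hx

/-- The conditional risk functional maps `L^p` to `L^p`. -/
theorem memLp_riskFunctional {m : Measure X} [SFinite m] (hpp : p.HolderConjugate p')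
    (hp' : 1 < p') (hp0 : p ≠ 0) (hp : p ≠ ∞) (hS : IsBoundedDistortionFamily p' M S)
    (hM : M ≠ ∞) {F : X × Ω → ℝ} (hF : MemLp F p (m ⊗ₘ κ)) :
    MemLp (fun x => riskFunctional S (κ x) fun ω => F (x, ω)) p m := by
  refine ⟨(aemeasurable_riskFunctional hpp hp' hp0 hp hS hM hF).aestronglyMeasurable,
    (eLpNorm_lt_top_iff_lintegral_rpow_enorm_lt_top hp0 hp).2 ?_⟩
  have hp_pos : 0 < p.toReal := ENNReal.toReal_pos hp0 hp
  have hfin := lintegral_rpow_enorm_lt_top_of_eLpNorm_lt_top hp0 hp hF.2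
  have hmeas := hF.1.stronglyMeasurable_mk.measurable.enorm.pow_const p.toReal
  rw [lintegral_rpow_enorm_congr_ae hF.1.ae_eq_mk,
    Measure.lintegral_compProd hmeas] at hfin
  calc ∫⁻ x, ‖riskFunctional S (κ x) fun ω => F (x, ω)‖ₑ ^ p.toReal ∂m
      ≤ ∫⁻ x, M ^ p.toReal * ∫⁻ ω, ‖hF.1.mk F (x, ω)‖ₑ ^ p.toReal ∂κ x ∂m := by
        refine lintegral_mono_ae ?_
        filter_upwards [ae_memLp_of_memLp_compProd hp0 hp hF,
          Measure.ae_ae_of_ae_compProd hF.1.ae_eq_mk] with x hx hx'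
        have h1 := ENNReal.rpow_le_rpow (enorm_riskFunctional_le hpp hp' hS hM hx) hp_pos.le
        rw [ENNReal.mul_rpow_of_nonneg _ _ hp_pos.le,
          eLpNorm_eq_lintegral_rpow_enorm_toReal hp0 hp, ← ENNReal.rpow_mul,
          one_div_mul_cancel hp_pos.ne', ENNReal.rpow_one,
          lintegral_rpow_enorm_congr_ae hx'] at h1
        exact h1
    _ < ∞ := by
        rw [lintegral_const_mul' _ _ (ENNReal.rpow_ne_top_of_nonneg hp_pos.le hM)]
        exact ENNReal.mul_lt_top (ENNReal.rpow_lt_top_of_nonneg hp_pos.le hM) hfin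

end Kernel

/-! ### Contraction along the stages -/

theorem lintegral_rpow_le_rpow_lintegral {Ω : Type*} [MeasurableSpace Ω] (π : Measure Ω)
    [IsProbabilityMeasure π] (h : Ω → ℝ≥0∞) {β : ℝ} (hβ : 0 < β) (hβ1 : β ≤ 1) :
    ∫⁻ z, h z ^ β ∂π ≤ (∫⁻ z, h z ∂π) ^ β := by
  -- The function `h` need not be measurable, as it will be built from a cost process. A measurable
  -- minorant of `h ^ β` with the same integral reduces the claim to the measurable case.
  obtain ⟨g, hg, hgh, hint⟩ := exists_measurable_le_lintegral_eq π fun z => h z ^ β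
  set k : Ω → ℝ≥0∞ := fun z => g z ^ (1 / β) with hk
  have hkm : Measurable k := hg.pow_const _
  have hkh : ∀ z, k z ≤ h z := fun z => by
    have := ENNReal.rpow_le_rpow (hgh z) (one_div_nonneg.2 hβ.le)
    rwa [← ENNReal.rpow_mul, mul_one_div_cancel hβ.ne', ENNReal.rpow_one] at this
  have hgk : ∀ z, g z = k z ^ β := fun z => by
    rw [hk, ← ENNReal.rpow_mul, one_div_mul_cancel hβ.ne', ENNReal.rpow_one]
  have h1 := eLpNorm'_le_eLpNorm'_of_exponent_le hβ hβ1 π hkm.aestronglyMeasurable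
  simp only [eLpNorm', enorm_eq_self, ENNReal.rpow_one, div_one] at h1
  rw [hint]
  simp_rw [hgk]
  calc ∫⁻ z, k z ^ β ∂π = ((∫⁻ z, k z ^ β ∂π) ^ (1 / β)) ^ β := by
        rw [← ENNReal.rpow_mul, one_div_mul_cancel hβ.ne', ENNReal.rpow_one]
    _ ≤ (∫⁻ z, k z ∂π) ^ β := ENNReal.rpow_le_rpow h1 hβ.le
    _ ≤ (∫⁻ z, h z ∂π) ^ β := ENNReal.rpow_le_rpow (lintegral_mono hkh) hβ.le

theorem eLpNorm_le_of_enorm_le_mul_rpow {Ω : Type*} [MeasurableSpace Ω] {π : Measure Ω}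
    [IsProbabilityMeasure π] {f : Ω → ℝ} {c : Ω → ℝ≥0∞} {C : ℝ≥0∞} (hC : C ≠ ∞) {β r : ℝ}
    (hβ : 0 < β) (hβ1 : β ≤ 1) (hr : 0 < r) (h : ∀ᵐ z ∂π, ‖f z‖ₑ ≤ C * c z ^ β) :
    eLpNorm f (ENNReal.ofReal r) π ≤ C * ((∫⁻ z, c z ^ r ∂π) ^ (1 / r)) ^ β := by
  rw [eLpNorm_eq_lintegral_rpow_enorm_toReal (by simpa using hr) ENNReal.ofReal_ne_top,
    ENNReal.toReal_ofReal hr.le]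
  calc (∫⁻ z, ‖f z‖ₑ ^ r ∂π) ^ (1 / r)
      ≤ (∫⁻ z, C ^ r * (c z ^ r) ^ β ∂π) ^ (1 / r) := by
        refine ENNReal.rpow_le_rpow (lintegral_mono_ae ?_) (one_div_nonneg.2 hr.le)
        filter_upwards [h] with z hz
        refine (ENNReal.rpow_le_rpow hz hr.le).trans (le_of_eq ?_)
        rw [ENNReal.mul_rpow_of_nonneg _ _ hr.le, ← ENNReal.rpow_mul, ← ENNReal.rpow_mul,
          mul_comm β r]
    _ ≤ (C ^ r * (∫⁻ z, c z ^ r ∂π) ^ β) ^ (1 / r) := by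
        rw [lintegral_const_mul' _ _ (ENNReal.rpow_ne_top_of_nonneg hr.le hC)]
        gcongr
        exact lintegral_rpow_le_rpow_lintegral π _ hβ hβ1
    _ = _ := by
        rw [ENNReal.mul_rpow_of_nonneg _ _ (one_div_nonneg.2 hr.le), ← ENNReal.rpow_mul,
          ← ENNReal.rpow_mul, ← ENNReal.rpow_mul, mul_one_div_cancel hr.ne', ENNReal.rpow_one,
          mul_comm β]

theorem le_mul_iInf_rpow {ι : Sort*} {x D : ℝ≥0∞} (hD : D ≠ ∞) {β : ℝ} (hβ : 0 < β)
    {I : ι → ℝ≥0∞} (h : ∀ i, x ≤ D * I i ^ β) (hι : Nonempty ι) : x ≤ D * (⨅ i, I i) ^ β := by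
  rcases eq_or_ne D 0 with rfl | hD0
  · obtain ⟨i⟩ := hι
    simpa using h i
  have h1 : (x / D) ^ (1 / β) ≤ ⨅ i, I i := by
    refine le_iInf fun i => ?_
    have h2 : x / D ≤ I i ^ β := ENNReal.div_le_of_le_mul' (h i)
    have h3 := ENNReal.rpow_le_rpow h2 (one_div_nonneg.2 hβ.le)
    rwa [← ENNReal.rpow_mul, mul_one_div_cancel hβ.ne', ENNReal.rpow_one] at h3
  have h4 := ENNReal.rpow_le_rpow h1 hβ.le
  rw [← ENNReal.rpow_mul, one_div_mul_cancel hβ.ne', ENNReal.rpow_one] at h4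
  rw [mul_comm]
  exact (ENNReal.div_le_iff hD0 hD).1 h4

theorem le_mul_wasserstein_rpow {Ω Ω' : Type*} [MeasurableSpace Ω] [MeasurableSpace Ω']
    {μ : Measure Ω} {ν : Measure Ω'} [IsProbabilityMeasure μ] [IsProbabilityMeasure ν] {r : ℝ}
    {c : Ω → Ω' → ℝ≥0∞} {x D : ℝ≥0∞} (hD : D ≠ ∞) {β : ℝ} (hβ : 0 < β)
    (h : ∀ π : Measure (Ω × Ω'), π.fst = μ → π.snd = ν →
      x ≤ D * ((∫⁻ z, c z.1 z.2 ^ r ∂π) ^ (1 / r)) ^ β) :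
    x ≤ D * wasserstein r μ ν c ^ β := by
  rw [wasserstein, iInf_subtype']
  exact le_mul_iInf_rpow hD hβ (fun π => h π.1 π.2.1 π.2.2) ⟨μ.prod ν, by simp, by simp⟩

theorem isProbabilityMeasure_of_fst {Ω Ω' : Type*} [MeasurableSpace Ω] [MeasurableSpace Ω']
    {μ : Measure Ω} [IsProbabilityMeasure μ] {π : Measure (Ω × Ω')} (h : π.fst = μ) :
    IsProbabilityMeasure π :=
  ⟨by rw [← Measure.fst_univ, h]; exact measure_univ⟩

theorem ae_of_marginals {Ω Ω' : Type*} [MeasurableSpace Ω] [MeasurableSpace Ω']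
    {μ : Measure Ω} {ν : Measure Ω'} {π : Measure (Ω × Ω')} (h1 : π.fst = μ) (h2 : π.snd = ν)
    {A : Set Ω} {B : Set Ω'} (hA : A ∈ ae μ) (hB : B ∈ ae ν) :
    ∀ᵐ z ∂π, z.1 ∈ A ∧ z.2 ∈ B := by
  have hmf : MeasurePreserving (Prod.fst : Ω × Ω' → Ω) π μ := ⟨measurable_fst, h1⟩
  have hms : MeasurePreserving (Prod.snd : Ω × Ω' → Ω') π ν := ⟨measurable_snd, h2⟩
  exact (hmf.quasiMeasurePreserving.ae hA).and (hms.quasiMeasurePreserving.ae hB)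

/-- Risk functionals are Hölder continuous with respect to the Wasserstein distance. -/
theorem enorm_riskFunctional_sub_le_wasserstein {Ω Ω' : Type*} [MeasurableSpace Ω]
    [MeasurableSpace Ω'] {μ : Measure Ω} {ν : Measure Ω'} [IsProbabilityMeasure μ]
    [IsProbabilityMeasure ν] {S : Set (ℝ → ℝ)} {p p' M q K : ℝ≥0∞} {r : ℝ}
    (hpp : p.HolderConjugate p') (hp' : 1 < p') (hS : IsBoundedDistortionFamily p' M S)
    (hM : M ≠ ∞) (hr : 0 < r) (hrq : (ENNReal.ofReal r).HolderConjugate q) (hq : 1 < q)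
    (hS' : IsBoundedDistortionFamily q K S) (hK : K ≠ ∞) {Y : Ω → ℝ} {Z : Ω' → ℝ}
    (hY : MemLp Y p μ) (hZ : MemLp Z p ν) {c : Ω → Ω' → ℝ≥0∞} {C : ℝ≥0∞} (hC : C ≠ ∞) {β : ℝ}
    (hβ : 0 < β) (hβ1 : β ≤ 1) {A : Set Ω} {B : Set Ω'} (hA : A ∈ ae μ) (hB : B ∈ ae ν)
    (h : ∀ u ∈ A, ∀ v ∈ B, ‖Y u - Z v‖ₑ ≤ C * c u v ^ β) :
    ‖riskFunctional S μ Y - riskFunctional S ν Z‖ₑ ≤ K * C * wasserstein r μ ν c ^ β := by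
  refine le_mul_wasserstein_rpow (ENNReal.mul_ne_top hK hC) hβ fun π h1 h2 => ?_
  have := isProbabilityMeasure_of_fst h1
  refine (enorm_riskFunctional_sub_le hpp hp' hS hM hrq hq hS' hY hZ h1 h2).trans ?_
  rw [mul_assoc]
  gcongr
  refine eLpNorm_le_of_enorm_le_mul_rpow (c := fun z : Ω × Ω' => c z.1 z.2) hC hβ hβ1 hr ?_
  filter_upwards [ae_of_marginals h1 h2 hA hB] with z hz using h _ hz.1 _ hz.2

section Snoc

variable {n : ℕ} {Ξ : Fin (n + 1) → Type u} [∀ i, MeasurableSpace (Ξ i)]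

theorem measurable_init : Measurable fun (x : ∀ i, Ξ i) (i : Fin n) => x i.castSucc :=
  measurable_pi_lambda _ fun i => measurable_pi_apply i.castSucc

theorem measurable_snoc : Measurable fun z : (∀ i : Fin n, Ξ i.castSucc) × Ξ (Fin.last n) =>
    (Fin.snoc (α := Ξ) z.1 z.2 : ∀ i, Ξ i) := by
  refine measurable_pi_lambda _ fun i => ?_
  refine Fin.lastCases ?_ (fun i => ?_) i
  · simpa using measurable_snd
  · simpa using! (measurable_pi_apply i).comp measurable_fst

instance isProbabilityMeasure_initMarginal (P : Measure (∀ i, Ξ i)) [IsProbabilityMeasure P] :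
    IsProbabilityMeasure (initMarginal P) :=
  Measure.isProbabilityMeasure_map measurable_init.aemeasurable

/-- A measure on a product disintegrates into its marginal on the first coordinates and the
conditional distribution of the last one. -/
theorem measurePreserving_snoc [∀ i, StandardBorelSpace (Ξ i)] [∀ i, Nonempty (Ξ i)]
    (P : Measure (∀ i, Ξ i)) [IsFiniteMeasure P] :
    MeasurePreserving (fun z : (∀ i : Fin n, Ξ i.castSucc) × Ξ (Fin.last n) =>
      (Fin.snoc (α := Ξ) z.1 z.2 : ∀ i, Ξ i)) (initMarginal P ⊗ₘ lastKernel P) P := by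
  refine ⟨measurable_snoc, ?_⟩
  rw [initMarginal, lastKernel, compProd_map_condDistrib (measurable_pi_apply _).aemeasurable,
    Measure.map_map measurable_snoc (measurable_init.prodMk (measurable_pi_apply _))]
  convert Measure.map_id
  ext x i
  refine Fin.lastCases ?_ (fun i => ?_) i <;> simp

end Snoc

/-- Induction on the number of stages, removing the last one. Two functions `Y` and `Z` are needed
because the conditional risks under `P` and `Q` differ even when the terminal functions agree. The
conull sets `A` and `B` are needed because the one-stage estimate requires integrable fibers. -/
theorem enorm_nestedRisk_sub_le {p p' q : ℝ≥0∞} {r β : ℝ} (hpp : p.HolderConjugate p')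
    (hp' : 1 < p') (hp0 : p ≠ 0) (hp : p ≠ ∞) (hr : 0 < r)
    (hrq : (ENNReal.ofReal r).HolderConjugate q) (hq : 1 < q) (hβ : 0 < β) (hβ1 : β ≤ 1) :
    ∀ {n : ℕ} {Ξ : Fin n → Type u} [∀ i, MeasurableSpace (Ξ i)] [∀ i, StandardBorelSpace (Ξ i)]
      [∀ i, Nonempty (Ξ i)] (S : Fin n → Set (ℝ → ℝ)) (M K : Fin n → ℝ≥0∞)
      (_ : ∀ i, IsBoundedDistortionFamily p' (M i) (S i)) (_ : ∀ i, M i ≠ ∞)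
      (_ : ∀ i, IsBoundedDistortionFamily q (K i) (S i)) (_ : ∀ i, K i ≠ ∞)
      (P Q : Measure (∀ i, Ξ i)) [IsProbabilityMeasure P] [IsProbabilityMeasure Q]
      (Y Z : (∀ i, Ξ i) → ℝ) (_ : MemLp Y p P) (_ : MemLp Z p Q)
      (c : (∀ i, Ξ i) → (∀ i, Ξ i) → ℝ≥0∞) (C : ℝ≥0∞) (_ : C ≠ ∞) (A B : Set (∀ i, Ξ i))
      (_ : A ∈ ae P) (_ : B ∈ ae Q) (_ : ∀ x ∈ A, ∀ y ∈ B, ‖Y x - Z y‖ₑ ≤ C * c x y ^ β),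
      ‖nestedRisk S P Y - nestedRisk S Q Z‖ₑ ≤ (∏ i, K i) * C * initialCost r P Q c ^ β := by
  intro n
  induction n with
  | zero =>
    intro Ξ _ _ _ S M K _ _ _ _ P Q _ _ Y Z _ _ c C _ A B hA hB h
    -- The empty product is a single point, which lies in every set of full measure.
    obtain ⟨x, hx⟩ := Filter.nonempty_of_mem hA
    obtain ⟨y, hy⟩ := Filter.nonempty_of_mem hB
    have := h x hx y hy
    rw [Subsingleton.elim x fun i => i.elim0, Subsingleton.elim y fun i => i.elim0] at this
    simpa [nestedRisk, initialCost] using this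
  | succ n ih =>
    intro Ξ _ _ _ S M K hS hM hS' hK P Q _ _ Y Z hY hZ c C hC A B hA hB h
    have hYF := hY.comp_measurePreserving (measurePreserving_snoc P)
    have hZF := hZ.comp_measurePreserving (measurePreserving_snoc Q)
    have hAe := Measure.ae_ae_of_ae_compProd
      ((measurePreserving_snoc P).quasiMeasurePreserving.ae hA)
    have hBe := Measure.ae_ae_of_ae_compProd
      ((measurePreserving_snoc Q).quasiMeasurePreserving.ae hB)
    have key := ih (Ξ := fun i : Fin n => Ξ i.castSucc) (fun i => S i.castSucc)
      (fun i => M i.castSucc) (fun i => K i.castSucc) (fun i => hS _) (fun i => hM _)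
      (fun i => hS' _) (fun i => hK _) (initMarginal P) (initMarginal Q) _ _
      (memLp_riskFunctional hpp hp' hp0 hp (hS (Fin.last n)) (hM _) hYF)
      (memLp_riskFunctional hpp hp' hp0 hp (hS (Fin.last n)) (hM _) hZF)
      (fun x y => wasserstein r (lastKernel P x) (lastKernel Q y)
        (fun u v => c (Fin.snoc (α := Ξ) x u) (Fin.snoc (α := Ξ) y v)))
      (K (Fin.last n) * C) (ENNReal.mul_ne_top (hK _) hC) _ _
      ((ae_memLp_of_memLp_compProd hp0 hp hYF).and hAe)
      ((ae_memLp_of_memLp_compProd hp0 hp hZF).and hBe)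
      (fun x hx y hy => enorm_riskFunctional_sub_le_wasserstein hpp hp' (hS _) (hM _) hr hrq hq
        (hS' _) (hK _) hx.1 hy.1 hC hβ hβ1 hx.2 hy.2 fun u hu v hv => h _ hu _ hv)
    rw [Fin.prod_univ_castSucc, mul_assoc (∏ i : Fin n, K i.castSucc)]
    exact key

/-! ### Measures at nested distance zero -/

/-- The same backward induction with expectations in place of risk functionals and `β = 1`; it shows
that the nested distance controls integrals of bounded Lipschitz functions. Boundedness keeps every
fiber integrable, so no exceptional sets appear. -/
theorem enorm_integral_sub_le_initialCost {r : ℝ} (hr : 1 ≤ r) {b : ℝ} :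
    ∀ {n : ℕ} {Ξ : Fin n → Type u} [∀ i, MeasurableSpace (Ξ i)] [∀ i, StandardBorelSpace (Ξ i)]
      [∀ i, Nonempty (Ξ i)] (P Q : Measure (∀ i, Ξ i)) [IsProbabilityMeasure P]
      [IsProbabilityMeasure Q] (f g : (∀ i, Ξ i) → ℝ) (_ : Measurable f) (_ : Measurable g)
      (_ : ∀ x, ‖f x‖ ≤ b) (_ : ∀ x, ‖g x‖ ≤ b) (c : (∀ i, Ξ i) → (∀ i, Ξ i) → ℝ≥0∞) (C : ℝ≥0∞)
      (_ : C ≠ ∞) (_ : ∀ x y, ‖f x - g y‖ₑ ≤ C * c x y),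
      ‖∫ x, f x ∂P - ∫ x, g x ∂Q‖ₑ ≤ C * initialCost r P Q c := by
  intro n
  induction n with
  | zero =>
    intro Ξ _ _ _ P Q _ _ f g _ _ _ _ c C _ h
    have hf : f = fun _ => f fun i => i.elim0 := funext fun x => by rw [Subsingleton.elim x]
    have hg : g = fun _ => g fun i => i.elim0 := funext fun x => by rw [Subsingleton.elim x]
    rw [hf, hg]
    simpa [initialCost] using h _ _
  | succ n ih =>
    intro Ξ _ _ _ P Q _ _ f g hf hg hfb hgb c C hC h
    have hint : ∀ (τ : Measure (∀ i, Ξ i)) [IsProbabilityMeasure τ] (k : (∀ i, Ξ i) → ℝ),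
        Measurable k → (∀ x, ‖k x‖ ≤ b) →
        ∫ x, k x ∂τ = ∫ x, ∫ u, k (Fin.snoc (α := Ξ) x u) ∂lastKernel τ x ∂initMarginal τ := by
      intro τ _ k hk hkb
      rw [← (measurePreserving_snoc τ).integral_comp_of_aestronglyMeasurable
        hk.aestronglyMeasurable]
      exact Measure.integral_compProd (Integrable.of_bound
        (hk.comp measurable_snoc).aestronglyMeasurable b (ae_of_all _ fun z => hkb _))
    have hmeas : ∀ (τ : Measure (∀ i, Ξ i)) [IsProbabilityMeasure τ] (k : (∀ i, Ξ i) → ℝ),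
        Measurable k → Measurable fun x : ∀ i : Fin n, Ξ i.castSucc =>
          ∫ u, k (Fin.snoc (α := Ξ) x u) ∂lastKernel τ x := fun τ _ k hk =>
      (StronglyMeasurable.integral_kernel_prod_right' (κ := lastKernel τ)
        (hk.comp measurable_snoc).stronglyMeasurable).measurable
    have hbound : ∀ (τ : Measure (∀ i, Ξ i)) [IsProbabilityMeasure τ] (k : (∀ i, Ξ i) → ℝ),
        (∀ x, ‖k x‖ ≤ b) → ∀ x : ∀ i : Fin n, Ξ i.castSucc,
          ‖∫ u, k (Fin.snoc (α := Ξ) x u) ∂lastKernel τ x‖ ≤ b := fun τ _ k hkb x => by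
      simpa using norm_integral_le_of_norm_le_const (μ := lastKernel τ x)
        (ae_of_all _ fun u => hkb (Fin.snoc (α := Ξ) x u))
    rw [hint P f hf hfb, hint Q g hg hgb]
    refine ih (Ξ := fun i : Fin n => Ξ i.castSucc) (initMarginal P) (initMarginal Q) _ _
      (hmeas P f hf) (hmeas Q g hg) (hbound P f hfb) (hbound Q g hgb) _ C hC fun x y => ?_
    rw [← ENNReal.rpow_one (wasserstein _ _ _ _)]
    refine le_mul_wasserstein_rpow hC one_pos fun π h1 h2 => ?_
    have := isProbabilityMeasure_of_fst h1
    have hfx : Measurable fun u => f (Fin.snoc (α := Ξ) x u) :=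
      hf.comp (measurable_snoc.comp measurable_prodMk_left)
    have hgy : Measurable fun u => g (Fin.snoc (α := Ξ) y u) :=
      hg.comp (measurable_snoc.comp measurable_prodMk_left)
    rw [← MeasurePreserving.integral_comp_of_aestronglyMeasurable ⟨measurable_fst, h1⟩
        hfx.aestronglyMeasurable,
      ← MeasurePreserving.integral_comp_of_aestronglyMeasurable ⟨measurable_snd, h2⟩
        hgy.aestronglyMeasurable, ← integral_sub]
    rotate_left
    · exact Integrable.of_bound (hfx.comp measurable_fst).aestronglyMeasurable b
        (ae_of_all _ fun z => hfb _)
    · exact Integrable.of_bound (hgy.comp measurable_snd).aestronglyMeasurable b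
        (ae_of_all _ fun z => hgb _)
    refine (enorm_integral_le_lintegral_enorm _).trans ?_
    rw [← eLpNorm_one_eq_lintegral_enorm]
    refine (eLpNorm_le_eLpNorm_of_exponent_le (ENNReal.one_le_ofReal.2 hr)
      ((hfx.comp measurable_fst).sub (hgy.comp measurable_snd)).aestronglyMeasurable).trans ?_
    refine eLpNorm_le_of_enorm_le_mul_rpow (c := fun z : Ξ (Fin.last n) × Ξ (Fin.last n) =>
      c (Fin.snoc (α := Ξ) x z.1)
      (Fin.snoc (α := Ξ) y z.2)) hC one_pos le_rfl (by linarith) (ae_of_all _ fun z => ?_)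
    rw [ENNReal.rpow_one]
    exact h _ _

/-- Thickened indicators are bounded, Lipschitz, and converge to the indicator of a closed set; the
closed sets form a π-system generating the Borel σ-algebra. -/
theorem MeasureTheory.Measure.ext_of_forall_lipschitzWith {X : Type*} [PseudoMetricSpace X]
    [MeasurableSpace X] [BorelSpace X] {P Q : Measure X} [IsProbabilityMeasure P]
    [IsProbabilityMeasure Q]
    (h : ∀ (K : ℝ≥0) (f : X → ℝ), LipschitzWith K f → (∀ x, ‖f x‖ ≤ 1) →
      ∫ x, f x ∂P = ∫ x, f x ∂Q) : P = Q := by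
  have key : ∀ F : Set X, IsClosed F → P F = Q F := by
    intro F hF
    have hδ : ∀ n : ℕ, (0 : ℝ) < 1 / ((n : ℝ) + 1) := fun n => Nat.one_div_pos_of_nat
    have hP := tendsto_lintegral_thickenedIndicator_of_isClosed P hF hδ
      tendsto_one_div_add_atTop_nhds_zero_nat
    have hQ := tendsto_lintegral_thickenedIndicator_of_isClosed Q hF hδ
      tendsto_one_div_add_atTop_nhds_zero_nat
    have heq : ∀ n, ∫⁻ x, thickenedIndicator (hδ n) F x ∂P =
        ∫⁻ x, thickenedIndicator (hδ n) F x ∂Q := by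
      intro n
      have hL : LipschitzWith _ fun x => (thickenedIndicator (hδ n) F x : ℝ) :=
        (isometry_subtype_coe (s := {x : ℝ | 0 ≤ x})).lipschitz.comp
          (lipschitzWith_thickenedIndicator (hδ n) F)
      have h1 := h _ _ hL fun x => by
        rw [NNReal.norm_eq]
        exact_mod_cast thickenedIndicator_le_one (hδ n) F x
      rw [← BoundedContinuousFunction.toReal_lintegral_coe_eq_integral,
        ← BoundedContinuousFunction.toReal_lintegral_coe_eq_integral] at h1
      exact (ENNReal.toReal_eq_toReal_iff'
        (BoundedContinuousFunction.lintegral_lt_top_of_nnreal P _).ne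
        (BoundedContinuousFunction.lintegral_lt_top_of_nnreal Q _).ne).1 h1
    simp_rw [heq] at hP
    exact tendsto_nhds_unique hP hQ
  refine ext_of_generate_finite _ ?_ isPiSystem_isClosed (fun F hF => key F hF) (by simp)
  rw [BorelSpace.measurable_eq (α := X), borel_eq_generateFrom_isClosed]

theorem eq_of_nestedDistance_eq_zero {n : ℕ} {Ξ : Fin n → Type u} [∀ i, TopologicalSpace (Ξ i)]
    [∀ i, PolishSpace (Ξ i)] [∀ i, MeasurableSpace (Ξ i)] [∀ i, BorelSpace (Ξ i)]
    [∀ i, Nonempty (Ξ i)] (d : MetricSpace (∀ i, Ξ i))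
    (hd : d.toUniformSpace.toTopologicalSpace = Pi.topologicalSpace) {r : ℝ} (hr : 1 ≤ r)
    (P Q : Measure (∀ i, Ξ i)) [IsProbabilityMeasure P] [IsProbabilityMeasure Q]
    (h : nestedDistance d r P Q = 0) : P = Q := by
  have hB : BorelSpace (∀ i, Ξ i) := inferInstance
  -- The metric now carries the product topology itself, so that the product σ-algebra is its Borel
  -- σ-algebra.
  let _ := d.replaceTopology hd.symm
  refine Measure.ext_of_forall_lipschitzWith fun K f hf hfb => ?_
  have hm : Measurable f := hf.continuous.measurable
  have key := enorm_integral_sub_le_initialCost hr P Q f f hm hm hfb hfb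
    (fun x y => ENNReal.ofReal (d.dist x y)) K ENNReal.coe_ne_top fun x y => by
      rw [← edist_eq_enorm_sub]
      refine (hf x y).trans (le_of_eq ?_)
      rw [edist_dist]
  rw [nestedDistance] at h
  rw [h, mul_zero, nonpos_iff_eq_zero, enorm_eq_zero, sub_eq_zero] at key
  exact key

/-! ### The continuity theorem -/

theorem nestedRisk_const (c : ℝ) :
    ∀ {n : ℕ} {Ξ : Fin n → Type u} [∀ i, MeasurableSpace (Ξ i)] [∀ i, StandardBorelSpace (Ξ i)]
      [∀ i, Nonempty (Ξ i)] (S : Fin n → Set (ℝ → ℝ)) (_ : ∀ i, (S i).Nonempty)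
      (_ : ∀ i, ∀ σ ∈ S i, IsDistortion σ) (P : Measure (∀ i, Ξ i)) [IsProbabilityMeasure P],
      nestedRisk S P (fun _ => c) = c := by
  intro n
  induction n with
  | zero => intros; rfl
  | succ n ih =>
    intro Ξ _ _ _ S hne hS P _
    have h1 : ∀ x, riskFunctional (S (Fin.last n)) (lastKernel P x) (fun _ => c) = c := fun x =>
      riskFunctional_const (hne _) (hS _) c
    simp only [nestedRisk, h1]
    exact ih (Ξ := fun i : Fin n => Ξ i.castSucc) _ (fun i => hne _) (fun i => hS _) _

/-- Stagewise estimates produce a product of suprema, whereas the theorem has a supremum over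
tuples. The choices are independent: changing a tuple at `j` leaves the factors over `s` unchanged.
-/
theorem ENNReal.prod_iSup_le_iSup_prod {ι α : Type*} [DecidableEq ι] (S : ι → Set α)
    (hS : ∀ i, (S i).Nonempty) (a : α → ℝ≥0∞) (s : Finset ι) :
    ∏ i ∈ s, ⨆ x ∈ S i, a x ≤ ⨆ x ∈ {x : ι → α | ∀ i, x i ∈ S i}, ∏ i ∈ s, a (x i) := by
  choose x₀ hx₀ using hS
  induction s using Finset.induction_on with
  | empty =>
    simp only [Finset.prod_empty]
    exact le_iSup₂_of_le x₀ hx₀ le_rfl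
  | insert j s hj ih =>
    rw [Finset.prod_insert hj]
    refine (mul_le_mul_right ih _).trans ?_
    simp_rw [ENNReal.iSup_mul, ENNReal.mul_iSup]
    refine iSup₂_le fun y hy => iSup₂_le fun x hx => ?_
    refine le_iSup₂_of_le (Function.update x j y) (fun i => ?_) ?_
    · rcases eq_or_ne i j with rfl | hi
      · simpa using hy
      · simpa [hi] using hx i
    · rw [Finset.prod_insert hj, Function.update_self]
      refine mul_le_mul_right (le_of_eq (Finset.prod_congr rfl fun i hi => ?_)) _
      rw [Function.update_of_ne (ne_of_mem_of_not_mem hi hj)]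

theorem enorm_nestedRisk_sub_le_nestedDistance {n : ℕ} {Ξ : Fin n → Type u}
    [∀ i, MeasurableSpace (Ξ i)] [∀ i, StandardBorelSpace (Ξ i)] [∀ i, Nonempty (Ξ i)]
    (d : MetricSpace (∀ i, Ξ i)) (P Q : Measure (∀ i, Ξ i)) [IsProbabilityMeasure P]
    [IsProbabilityMeasure Q] {r : ℝ} (hr : 1 ≤ r) {q p p' : ℝ≥0∞}
    (hrq : (ENNReal.ofReal r).HolderConjugate q) (hpp : p.HolderConjugate p')
    (S : Fin n → Set (ℝ → ℝ)) {M K : Fin n → ℝ≥0∞}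
    (hS : ∀ i, IsBoundedDistortionFamily p' (M i) (S i)) (hM : ∀ i, M i ≠ ∞)
    (hS' : ∀ i, IsBoundedDistortionFamily q (K i) (S i)) (hK : ∀ i, K i ≠ ∞)
    {Y : (∀ i, Ξ i) → ℝ} (hYP : MemLp Y p P) (hYQ : MemLp Y p Q) (L : ℝ≥0) {β : ℝ} (hβ : 0 < β)
    (hβ1 : β ≤ 1) (hY : ∀ x y, |Y x - Y y| ≤ L * d.dist x y ^ β) :
    ‖nestedRisk S P Y - nestedRisk S Q Y‖ₑ ≤ (∏ i, K i) * L * nestedDistance d r P Q ^ β := by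
  have hr0 : 0 < r := by linarith
  have hq : 1 < q := (ENNReal.HolderConjugate.lt_top_iff_one_lt (ENNReal.ofReal r) q).1
    ENNReal.ofReal_lt_top
  have hcost : ∀ x ∈ Set.univ, ∀ y ∈ Set.univ,
      ‖Y x - Y y‖ₑ ≤ (L : ℝ≥0∞) * ENNReal.ofReal (d.dist x y) ^ β := fun x _ y _ => by
    have h0 : 0 ≤ d.dist x y := dist_nonneg
    rw [Real.enorm_eq_ofReal_abs, ENNReal.ofReal_rpow_of_nonneg h0 hβ.le,
      ← ENNReal.ofReal_coe_nnreal, ← ENNReal.ofReal_mul L.coe_nonneg]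
    exact ENNReal.ofReal_le_ofReal (hY x y)
  -- The induction needs a finite integrability exponent. If `p ≤ r`, then `p` is finite; otherwise
  -- `Y` lies in `L^r` as well, and the bounds `K` in `L^q` provide the required finiteness.
  rcases le_total p (ENNReal.ofReal r) with h | h
  · have hp : p ≠ ∞ := ne_top_of_le_ne_top ENNReal.ofReal_ne_top h
    exact enorm_nestedRisk_sub_le hpp
      ((ENNReal.HolderConjugate.lt_top_iff_one_lt p p').1 hp.lt_top)
      (ENNReal.HolderConjugate.ne_zero p p') hp hr0 hrq hq hβ hβ1 S M K hS hM hS' hK P Q Y Y hYP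
      hYQ _ L ENNReal.coe_ne_top _ _ Filter.univ_mem Filter.univ_mem hcost
  · exact enorm_nestedRisk_sub_le hrq hq (ENNReal.HolderConjugate.ne_zero _ q)
      ENNReal.ofReal_ne_top hr0 hrq hq hβ hβ1 S K K hS' hK hS' hK P Q Y Y (hYP.mono_exponent h)
      (hYQ.mono_exponent h) _ L ENNReal.coe_ne_top _ _ Filter.univ_mem Filter.univ_mem hcost

theorem mainTheorem2 {T : ℕ} {Ξ : Fin T → Type*} [∀ t, TopologicalSpace (Ξ t)]
    [∀ t, PolishSpace (Ξ t)] [∀ t, MeasurableSpace (Ξ t)] [∀ t, BorelSpace (Ξ t)]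
    [∀ t, Nonempty (Ξ t)]
    (d : MetricSpace (∀ t, Ξ t))
    (hd : d.toUniformSpace.toTopologicalSpace = Pi.topologicalSpace)
    (P Q : Measure (∀ t, Ξ t)) [IsProbabilityMeasure P] [IsProbabilityMeasure Q]
    (r : ℝ) (hr : 1 ≤ r) (q : ℝ≥0∞) (hrq : (ENNReal.ofReal r).HolderConjugate q)
    (p p' : ℝ≥0∞) (hp : p.HolderConjugate p')
    (S : Fin T → Set (ℝ → ℝ)) (hS_ne : ∀ t, (S t).Nonempty)
    (hS : ∀ t, ∀ σ ∈ S t, IsDistortion σ)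
    (hS_bdd : ∀ t, (⨆ σ ∈ S t, distortionNorm p' σ) < ∞)
    (Y : (∀ t, Ξ t) → ℝ) (hYP : MemLp Y p P) (hYQ : MemLp Y p Q)
    (L : ℝ≥0) (β : ℝ) (hβ : 0 < β) (hβ1 : β ≤ 1)
    (hY : ∀ x y, |Y x - Y y| ≤ L * d.dist x y ^ β) :
    ENNReal.ofReal |nestedRisk S P Y - nestedRisk S Q Y| ≤
      (⨆ σ ∈ {σ : Fin T → ℝ → ℝ | ∀ t, σ t ∈ S t}, ∏ t, distortionNorm q (σ t)) *
        L * nestedDistance d r P Q ^ β := by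
  have hq : 1 < q := (ENNReal.HolderConjugate.lt_top_iff_one_lt (ENNReal.ofReal r) q).1
    ENNReal.ofReal_lt_top
  rcases eq_or_ne L 0 with rfl | hL
  · obtain ⟨x₀⟩ : Nonempty (∀ t, Ξ t) := inferInstance
    have hconst : Y = fun _ => Y x₀ := funext fun x => by
      have := hY x x₀
      rw [NNReal.coe_zero, zero_mul] at this
      exact sub_eq_zero.1 (abs_nonpos_iff.1 this)
    rw [hconst, nestedRisk_const _ S hS_ne hS, nestedRisk_const _ S hS_ne hS]
    simp
  -- The supremum may be infinite here while the right-hand side is `0`, so the estimate cannot be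
  -- used and `P = Q` is needed.
  rcases eq_or_ne (nestedDistance d r P Q) 0 with h0 | h0
  · obtain rfl := eq_of_nestedDistance_eq_zero d hd hr P Q h0
    simp
  have hprod := ENNReal.prod_iSup_le_iSup_prod S hS_ne (distortionNorm q) Finset.univ
  rcases eq_or_ne (⨆ σ ∈ {σ : Fin T → ℝ → ℝ | ∀ t, σ t ∈ S t}, ∏ t, distortionNorm q (σ t)) ∞
    with htop | htop
  · rw [htop, ENNReal.top_mul (by simpa using hL), ENNReal.top_mul]
    · exact le_top
    · exact (ENNReal.rpow_pos_of_nonneg (pos_iff_ne_zero.2 h0) hβ.le).ne'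
  -- Since every factor is at least one, each is bounded by the product, and a finite supremum over
  -- tuples makes every stage bound finite.
  have hone : ∀ t, 1 ≤ ⨆ σ ∈ S t, distortionNorm q σ := fun t => by
    obtain ⟨σ, hσ⟩ := hS_ne t
    exact ((hS t σ hσ).one_le_distortionNorm hq.le).trans
      (le_iSup₂ (f := fun σ (_ : σ ∈ S t) => distortionNorm q σ) σ hσ)
  rw [← Real.enorm_eq_ofReal_abs]
  refine (enorm_nestedRisk_sub_le_nestedDistance d P Q hr hrq hp S
    (fun t => ⟨hS_ne t, hS t, fun σ hσ =>
      le_iSup₂ (f := fun σ (_ : σ ∈ S t) => distortionNorm p' σ) σ hσ⟩)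
    (fun t => (hS_bdd t).ne)
    (fun t => ⟨hS_ne t, hS t, fun σ hσ =>
      le_iSup₂ (f := fun σ (_ : σ ∈ S t) => distortionNorm q σ) σ hσ⟩)
    (fun t => ne_top_of_le_ne_top htop ((Finset.single_le_prod' (f := fun t =>
      ⨆ σ ∈ S t, distortionNorm q σ) (fun t _ => hone t) (Finset.mem_univ t)).trans hprod))
    hYP hYQ L hβ hβ1 hY).trans ?_
  gcongr
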